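/- Let $V$ be a finite set of points. A partial Steiner triple system $\mathcal{T}$ on $V$ is a collection of 3-element subsets of $V$, called blocks, such that any two distinct points of $V$ lie together in at most one block (points lying in no block are allowed). Two blocks are called disjoint if they have no point in common. $\mathcal{T}$ is called sequenceable if there is a sequence $\pi$ listing every point of $V$ exactly once such that no proper segment of $\pi$ (a set of consecutive entries of $\pi$ that is neither empty nor all of $\pi$) can be partitioned into pairwise disjoint blocks of $\mathcal{T}$. **Theorem.** Every partial Steiner triple system with at most three pairwise disjoint blocks (that is, containing no four pairwise disjoint blocks) is sequenceable. -/

import Mathlib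

/-- A partial Steiner triple system on the point set `V`: a collection of triples (the blocks, i.e.
the vertex sets of the triangles) that are pairwise edge-disjoint, so that two distinct points lie
together in at most one block. Points that lie in no block are allowed. -/
structure PartialSteinerTripleSystem (V : Type*) where
  /-- the set of blocks -/
  blocks : Set (Finset V)
  card_block : ∀ B ∈ blocks, B.card = 3
  edge_disjoint : ∀ B ∈ blocks, ∀ C ∈ blocks, ∀ x y : V, x ≠ y →
    x ∈ B → y ∈ B → x ∈ C → y ∈ C → B = C

/-- `s` is a proper segment of the sequence `l`: consecutive entries of `l`, neither empty nor
all of `l`. -/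
def IsProperSegment {Ω : Type*} (s l : List Ω) : Prop :=
  s <:+: l ∧ s ≠ [] ∧ s ≠ l

/-- `l` is an admissible sequence for the family `P` of subsets of `Ω` (regarded as a poset under
inclusion): `l` lists every element of the ground set `Ω` exactly once, and the set of entries of a
proper segment of `l` never belongs to `P`. -/
def IsAdmissibleSequence {Ω : Type*} [DecidableEq Ω] (P : Set (Finset Ω)) (l : List Ω) : Prop :=
  l.Nodup ∧ (∀ x : Ω, x ∈ l) ∧ ∀ s : List Ω, IsProperSegment s l → s.toFinset ∉ P

/-- A poset of subsets of `Ω` is sequenceable if it has an admissible sequence. -/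
def PosetSequenceable {Ω : Type*} [DecidableEq Ω] (P : Set (Finset Ω)) : Prop :=
  ∃ l : List Ω, IsAdmissibleSequence P l

namespace PartialSteinerTripleSystem

/-- `S` is a set of pairwise vertex-disjoint blocks of `T`. -/
def IsDisjointBlocks {V : Type*} (T : PartialSteinerTripleSystem V)
    (S : Finset (Finset V)) : Prop :=
  (∀ B ∈ S, B ∈ T.blocks) ∧ ∀ B ∈ S, ∀ C ∈ S, B ≠ C → Disjoint B C

/-- The associated poset of `T`: all sets of points that can be partitioned into pairwise
vertex-disjoint blocks. -/
def associatedPoset {V : Type*} [DecidableEq V] (T : PartialSteinerTripleSystem V) :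
    Set (Finset V) :=
  {A | ∃ S : Finset (Finset V), T.IsDisjointBlocks S ∧ S.biUnion id = A}

/-- `T` is sequenceable if its associated poset is sequenceable. -/
def Sequenceable {V : Type*} [DecidableEq V] (T : PartialSteinerTripleSystem V) : Prop :=
  PosetSequenceable T.associatedPoset

/-- `T` has at most `k` pairwise vertex-disjoint blocks. -/
def AtMostDisjointBlocks {V : Type*} (T : PartialSteinerTripleSystem V) (k : ℕ) : Prop :=
  ∀ S : Finset (Finset V), T.IsDisjointBlocks S → S.card ≤ k

end PartialSteinerTripleSystem

/-! ### A checker for certificates that a configuration of blocks forces a good sequence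

The points of a system are labelled by numbers. A certificate is a list of configurations of blocks,
each of which cannot occur in an unsequenceable system: it comes with a sequence of the points, and
every partition of one of its segments into blocks would either give too many disjoint blocks or
complete a copy of a configuration that was excluded before. The last configuration consists of
pairwise disjoint blocks only.

The checker is evaluated by the kernel, and this is much faster with plain recursors. -/

namespace SequenceCertificate

/-! Let `K` be the maximum number of pairwise disjoint blocks, and suppose that the system is not
sequenceable. Then every ordering of the points has a proper segment that splits into blocks; it has
3j points with 1 ≤ j ≤ K. So once some blocks are known to be present, a well chosen ordering forces
further ones. If every splitting of every segment would produce two blocks with two common points,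
`K + 1` disjoint blocks, or a relabelled copy of a configuration already shown to be impossible,
then the known configuration is impossible too. Working from rich configurations down to poorer
ones, one ends with `K` disjoint blocks alone. These do occur, a contradiction.

Finitely many searches suffice. If there are more points than labels, all unlabelled points are put
into one gap of the sequence. The labels near the gap are chosen so that a segment of 3j points
containing an unlabelled one meets at most j - 1 of the `K` base blocks; a splitting of it and the
base blocks it misses would be more than `K` disjoint blocks. Hence one certificate serves all sizes
from 6, 9 or 14 points on, for `K` = 1, 2, 3, and each size from 3K up to there has its own.

The search is sound because actual blocks survive its pruning (`conflict_eq_false`,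
`IsBlock.mem_candidates`, `noBadSegment_sound`). The gap is handled by `infix_meets_middle` and
`card_le_of_few_base`; `stepValid_sound` refutes one configuration and `certifies_sound` chains the
refutations. -/

noncomputable def both (a b : Bool) : Bool := Bool.rec false b a

noncomputable def either (a b : Bool) : Bool := Bool.rec b true a

noncomputable def forAll {α : Type} (p : α → Bool) (l : List α) : Bool :=
  List.rec (motive := fun _ => Bool) true (fun a _ ih => both (p a) ih) l

noncomputable def forSome {α : Type} (p : α → Bool) (l : List α) : Bool :=
  List.rec (motive := fun _ => Bool) false (fun a _ ih => either (p a) ih) l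

noncomputable def sieve {α : Type} (p : α → Bool) (l : List α) : List α :=
  List.rec (motive := fun _ => List α) [] (fun a _ ih => Bool.rec ih (a :: ih) (p a)) l

/-- The `i`-th hexadecimal digit of `s`, counted from the right. -/
def digit (s i : ℕ) : ℕ := Nat.land (Nat.shiftRight s (Nat.mul 4 i)) 15

/-- The `n` last hexadecimal digits of `s`, from the right to the left. -/
def digits (n s : ℕ) : List ℕ := (List.range n).map (digit s)

/-- The set `{a, b, c}` of labels as a bit mask. -/
def mask (a b c : ℕ) : ℕ := Nat.lor (Nat.pow 2 a) (Nat.lor (Nat.pow 2 b) (Nat.pow 2 c))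

/-- The mask of the image under `f` of the set of the last three digits of `t`. -/
def tripleMask (f : ℕ → ℕ) (t : ℕ) : ℕ := mask (f (digit t 0)) (f (digit t 1)) (f (digit t 2))

/-- The mask of a list of labels. -/
def listMask (l : List ℕ) : ℕ := l.foldr (fun d m => Nat.lor (Nat.pow 2 d) m) 0

/-- The elements of `l` are exactly the numbers below `n`. -/
def coversRange (n : ℕ) (l : List ℕ) : Bool :=
  Nat.beq (listMask l) (Nat.sub (Nat.pow 2 n) 1)

/-- A step of a certificate. In an unsequenceable system there is no copy of the configuration
`blocks`, because of the sequence `seq` of labels (further points are inserted at position `gap`).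
Each entry `(i, σ)` of `excluded` points to the image under `σ` of a configuration that was dealt
with before. -/
structure Step where
  blocks : List ℕ
  seq : ℕ
  gap : ℕ
  excluded : List (ℕ × ℕ)

noncomputable def mem (m : ℕ) (l : List ℕ) : Bool := forSome (Nat.beq m) l

/-- The masks `p` and `m` are equal or have at most one common element. -/
noncomputable def compatible (p m : ℕ) : Bool :=
  either (Nat.beq (Nat.land (Nat.land p m) (Nat.sub (Nat.land p m) 1)) 0) (Nat.beq p m)

/-- There are `k` members of `l` that are disjoint from each other and from `u`. -/
noncomputable def hasDisjoint (l : List ℕ) : ℕ → ℕ → Bool :=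
  List.rec (motive := fun _ => ℕ → ℕ → Bool) (fun k _ => Nat.beq k 0)
    (fun m _ ih k u => either (Nat.beq k 0)
      (either (ih k u) (both (Nat.beq (Nat.land m u) 0) (ih (Nat.pred k) (Nat.lor u m))))) l

/-- With the configuration `pos`, the masks `m :: new` cannot all be blocks, because they contain
one of the `nogoods` or because there are too many disjoint blocks. -/
noncomputable def conflict (K : ℕ) (pos : List ℕ) (nogoods : List (List ℕ)) (m : ℕ)
    (new : List ℕ) : Bool :=
  either (forSome (forAll fun x => mem x (m :: new)) nogoods) (hasDisjoint (new ++ pos) K m)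

/-- The masks of all triples of labels below `n`. -/
def triples (n : ℕ) : List ℕ :=
  (List.range n).flatMap fun a => (List.range a).flatMap fun b => (List.range b).map fun c =>
    mask a b c

/-- The masks of triples that may be blocks. -/
noncomputable def candidates (n K : ℕ) (pos : List ℕ) (nogoods : List (List ℕ)) : List ℕ :=
  sieve (fun m => both (forAll (fun p => compatible p m) pos)
    (Bool.rec true false (conflict K pos nogoods m []))) (triples n)

/-- It is not possible to partition the set with mask `w` into `j` blocks from the list, together
with the blocks in `new`. -/
noncomputable def noPartition (K : ℕ) (pos : List ℕ) (nogoods : List (List ℕ)) (l : List ℕ) :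
    ℕ → ℕ → List ℕ → Bool :=
  -- Reaching `j = 0` means that a partition was found, hence `false`. Whether the chosen masks
  -- exhaust `w` is not tested: counting them is enough for soundness.
  List.rec (motive := fun _ => ℕ → ℕ → List ℕ → Bool) (fun j _ _ => Nat.blt 0 j)
    (fun m _ ih j w new => both (Nat.blt 0 j) (both
      (Bool.rec true (either (ih (Nat.pred j) (Nat.xor w m) (m :: new))
        (conflict K pos nogoods m new)) (Nat.beq (Nat.land m w) m))
      (ih j w new))) l

/-- No segment of `p` can be partitioned into blocks, except perhaps `p` itself. -/
noncomputable def noBadSegment (n K : ℕ) (pos : List ℕ) (nogoods : List (List ℕ))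
    (p : List ℕ) : Bool :=
  -- Every segment is an initial part of a tail. One list of candidates, inside the first 3K labels
  -- of the tail, serves every `j`. A segment with `n = 3 * (j + 1)` labels is the full sequence,
  -- hence exempt.
  forAll (fun t => forAll (fun j => either
    (noPartition K pos nogoods
      (sieve (fun m => Nat.beq (Nat.land m (listMask (t.take (Nat.mul 3 K)))) m)
        (candidates n K pos nogoods))
      (Nat.succ j) (listMask (t.take (Nat.mul 3 (Nat.succ j)))) [])
    (Nat.beq n (Nat.mul 3 (Nat.succ j)))) (List.range K)) p.tails

/-- Triples that stand for the blocks of a maximum family of pairwise disjoint blocks. -/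
def baseTriples (K : ℕ) : List ℕ := [0x012, 0x345, 0x678].take K

/-- If the labels `P` are followed by new points and then by the labels `Q`, then a segment that
contains a new point meets too few base triples to be partitioned into blocks. -/
def extendable (K : ℕ) (P Q : List ℕ) : Bool :=
  -- A segment of 3(j + 1) entries with `a` of them before some new point reaches at most the last
  -- `a` labels of `P` and the first 3j + 2 - a of `Q`. The label `x` lies in base triple `x / 3`,
  -- and at most `j` base triples may be met.
  (List.range K).all fun j => (List.range (3 * (j + 1))).all fun a =>
    Nat.ble (K + 1) (j + 1 + (List.range K).countP fun i =>
      (P.drop (P.length - a) ++ Q.take (3 * j + 2 - a)).all fun x => !(Nat.beq (x / 3) i))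

/-- The set of blocks that, together with the configuration `pos`, gives the image of an earlier
configuration. -/
noncomputable def nogoodsOf (n : ℕ) (pos : List ℕ) (prev : List (List ℕ)) (h : ℕ × ℕ) :
    List (List ℕ) :=
  -- The latest configuration comes first in `prev`, so the index counts backwards from the current
  -- step. Blocks of the copy that already lie in `pos` are dropped; the remaining ones must not all
  -- occur.
  match prev[h.1]? with
  | none => []
  | some L =>
    if coversRange n (digits n h.2) then
      [sieve (fun m => Bool.rec true false (mem m pos)) (L.map (tripleMask (digit h.2)))]
    else []

noncomputable def stepValid (n K : ℕ) (ext : Bool) (prev : List (List ℕ)) (s : Step) : Bool :=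
  coversRange n (digits n s.seq) &&
  (s.blocks.map (tripleMask id)).all (fun m => Nat.ble (Nat.succ m) (Nat.pow 2 n)) &&
  noBadSegment n K (s.blocks.map (tripleMask id))
    (s.excluded.flatMap (nogoodsOf n (s.blocks.map (tripleMask id)) prev)) (digits n s.seq) &&
  (!ext || (Nat.ble (3 * K + 1) n && (baseTriples K).all (fun t => mem t s.blocks) &&
    extendable K ((digits n s.seq).take s.gap) ((digits n s.seq).drop s.gap)))

/-- The steps are valid, and the last one deals with a maximum family of disjoint blocks. -/
noncomputable def certifies (n K : ℕ) (ext : Bool) : List (List ℕ) → List Step → Bool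
  | [], [] => false
  | L :: _, [] => L.all fun t => mem t (baseTriples K)
  | prev, s :: ss => stepValid n K ext prev s && certifies n K ext (s.blocks :: prev) ss

/-! ### Masks -/

theorem both_eq (a b : Bool) : both a b = (a && b) := by cases a <;> rfl

theorem either_eq (a b : Bool) : either a b = (a || b) := by cases a <;> rfl

theorem forAll_eq {α : Type} (p : α → Bool) (l : List α) : forAll p l = l.all p := by
  induction l with
  | nil => rfl
  | cons a l ih => rw [List.all_cons, ← ih, ← both_eq]; rfl

theorem forSome_eq {α : Type} (p : α → Bool) (l : List α) : forSome p l = l.any p := by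
  induction l with
  | nil => rfl
  | cons a l ih => rw [List.any_cons, ← ih, ← either_eq]; rfl

theorem mem_sieve {α : Type} (p : α → Bool) (l : List α) (x : α) :
    x ∈ sieve p l ↔ x ∈ l ∧ p x = true := by
  have h : sieve p l = l.filter p := by
    induction l with
    | nil => rfl
    | cons a l ih =>
      rw [List.filter_cons, ← ih]
      cases h : p a <;> simp [sieve, h]
  rw [h, List.mem_filter]

theorem mem_iff (m : ℕ) (l : List ℕ) : mem m l = true ↔ m ∈ l := by
  simp [mem, forSome_eq]

theorem beq_iff (a b : ℕ) : Nat.beq a b = true ↔ a = b := Nat.beq_eq ▸ Iff.rfl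

theorem testBit_mask (a b c i : ℕ) :
    (mask a b c).testBit i = true ↔ i = a ∨ i = b ∨ i = c := by
  have : mask a b c = 2 ^ a ||| (2 ^ b ||| 2 ^ c) := rfl
  simp [this, Nat.testBit_or, Nat.testBit_two_pow, @eq_comm _ i]

theorem testBit_listMask (l : List ℕ) (i : ℕ) : (listMask l).testBit i = true ↔ i ∈ l := by
  induction l with
  | nil => simp [listMask]
  | cons a l ih =>
    have : listMask (a :: l) = 2 ^ a ||| listMask l := rfl
    simp [this, Nat.testBit_or, Nat.testBit_two_pow, ih, @eq_comm _ i]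

theorem lt_of_testBit {m n i : ℕ} (hm : m < 2 ^ n) (hi : m.testBit i = true) : i < n := by
  by_contra h
  rw [Nat.testBit_lt_two_pow (hm.trans_le (Nat.pow_le_pow_right two_pos (not_lt.1 h)))] at hi
  simp at hi

theorem lt_two_pow_of_testBit {m n : ℕ} (h : ∀ i, m.testBit i = true → i < n) : m < 2 ^ n :=
  Nat.lt_pow_two_of_testBit m fun i hi => by
    by_contra h'
    exact absurd (h i (by simpa using h')) (not_lt.2 hi)

theorem land_eq_left_iff (m w : ℕ) :
    Nat.land m w = m ↔ ∀ i, m.testBit i = true → w.testBit i = true := by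
  have h : Nat.land m w = m &&& w := rfl
  rw [h]
  constructor
  · intro h i hi
    rw [← h, Nat.testBit_and] at hi
    simp_all
  · intro h
    refine Nat.eq_of_testBit_eq fun i => ?_
    rw [Nat.testBit_and]
    specialize h i
    cases h1 : m.testBit i <;> simp_all

theorem land_eq_zero_iff (m w : ℕ) :
    Nat.land m w = 0 ↔ ∀ i, m.testBit i = true → w.testBit i = false := by
  have h : Nat.land m w = m &&& w := rfl
  rw [h]
  constructor
  · intro h i hi
    have := congrArg (·.testBit i) h
    simp only [Nat.testBit_and, Nat.zero_testBit, hi, Bool.true_and] at this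
    exact this
  · intro h
    refine Nat.eq_of_testBit_eq fun i => ?_
    rw [Nat.testBit_and, Nat.zero_testBit]
    specialize h i
    cases h1 : m.testBit i <;> simp_all

/-- Passing from `x` to `x &&& (x - 1)` clears the lowest bit, so the result vanishes only for 0 and
powers of two. -/
theorem exists_two_bits {x : ℕ} (h : Nat.land x (x - 1) ≠ 0) :
    ∃ i j, i ≠ j ∧ x.testBit i = true ∧ x.testBit j = true := by
  have hx : x ≠ 0 := by rintro rfl; exact h rfl
  obtain ⟨i, hi⟩ := Nat.exists_testBit_of_ne_zero hx
  by_contra hcon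
  push Not at hcon
  have hx2 : x = 2 ^ i := by
    refine Nat.eq_of_testBit_eq fun j => ?_
    rw [Nat.testBit_two_pow]
    by_cases hij : i = j
    · subst hij; simpa using hi
    · have := hcon i j hij hi
      simp [hij, this]
  apply h
  rw [land_eq_zero_iff]
  intro j hj
  rw [hx2, Nat.testBit_two_pow] at hj
  rw [hx2, Nat.testBit_two_pow_sub_one]
  simp_all

/-- The set of labels below `n` in the mask `m`. -/
def points (n m : ℕ) : Finset ℕ := (Finset.range n).filter fun i => m.testBit i = true

theorem mem_points {n m i : ℕ} : i ∈ points n m ↔ i < n ∧ m.testBit i = true := by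
  simp [points]

/-- The bounds are needed because `points n` does not see the bits from `n` on. -/
theorem points_injective {n m m' : ℕ} (hm : m < 2 ^ n) (hm' : m' < 2 ^ n)
    (h : points n m = points n m') : m = m' := by
  refine Nat.eq_of_testBit_eq fun i => ?_
  rw [Bool.eq_iff_iff]
  constructor
  · intro hi
    exact (mem_points.1 (h ▸ mem_points.2 ⟨lt_of_testBit hm hi, hi⟩)).2
  · intro hi
    exact (mem_points.1 (h ▸ mem_points.2 ⟨lt_of_testBit hm' hi, hi⟩)).2

theorem points_mask {n a b c : ℕ} (h : mask a b c < 2 ^ n) :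
    points n (mask a b c) = {a, b, c} := by
  ext i
  simp only [mem_points, testBit_mask, Finset.mem_insert, Finset.mem_singleton]
  exact ⟨fun h => h.2, fun hi => ⟨lt_of_testBit h ((testBit_mask a b c i).2 hi), hi⟩⟩

theorem coversRange_iff (n : ℕ) (l : List ℕ) :
    coversRange n l = true ↔ ∀ i, i ∈ l ↔ i < n := by
  have h : coversRange n l = true ↔ listMask l = 2 ^ n - 1 := beq_iff _ _
  rw [h]
  constructor
  · intro h i
    rw [← testBit_listMask, h, Nat.testBit_two_pow_sub_one, decide_eq_true_iff]
  · intro h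
    refine Nat.eq_of_testBit_eq fun i => ?_
    rw [Bool.eq_iff_iff, testBit_listMask, h, Nat.testBit_two_pow_sub_one, decide_eq_true_iff]

/-- Pigeonhole: `n` entries that take `n` values cannot repeat. Thus a single mask comparison
certifies a permutation of the labels. -/
theorem nodup_of_coversRange {n : ℕ} {l : List ℕ} (h : coversRange n l = true)
    (hl : l.length = n) : l.Nodup := by
  rw [coversRange_iff] at h
  have : l.toFinset = Finset.range n := by ext i; simp [h]
  rw [← Multiset.coe_nodup, ← Multiset.toFinset_card_eq_card_iff_nodup]
  change l.toFinset.card = l.length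
  rw [this, Finset.card_range, hl]

theorem length_digits (n s : ℕ) : (digits n s).length = n := by simp [digits]

theorem digit_injOn {n s : ℕ} (h : coversRange n (digits n s) = true) :
    Set.InjOn (digit s) (Set.Iio n) := by
  have := nodup_of_coversRange h (length_digits n s)
  rw [digits] at this
  intro a ha b hb hab
  exact List.inj_on_of_nodup_map this (by simpa using ha) (by simpa using hb) hab

theorem digit_lt {n s i : ℕ} (h : coversRange n (digits n s) = true) (hi : i < n) :
    digit s i < n := by
  rw [coversRange_iff] at h
  exact (h _).1 (List.mem_map.2 ⟨i, by simpa using hi, rfl⟩)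

theorem mem_triples {n a b c : ℕ} (ha : a < n) (hb : b < a) (hc : c < b) :
    mask a b c ∈ triples n := by
  simp only [triples, List.mem_flatMap, List.mem_map, List.mem_range]
  exact ⟨a, ha, b, hb, c, hc, rfl⟩

theorem mem_triples_of_card {n m : ℕ} (hm : m < 2 ^ n) (h : (points n m).card = 3) :
    m ∈ triples n := by
  obtain ⟨a, b, c, hab, hac, hbc, hp⟩ := Finset.card_eq_three.1 h
  have hmem : ∀ x, x = a ∨ x = b ∨ x = c → x < n := fun x hx =>
    (mem_points.1 (hp ▸ by simpa using hx : x ∈ points n m)).1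
  have key : ∀ x y z, x < n → y < x → z < y → ({x, y, z} : Finset ℕ) = {a, b, c} →
      m ∈ triples n := by
    intro x y z hx hy hz hxyz
    have hlt : mask x y z < 2 ^ n := lt_two_pow_of_testBit fun i hi => by
      rw [testBit_mask] at hi; omega
    rw [points_injective hm hlt (by rw [points_mask hlt, hp, hxyz])]
    exact mem_triples hx hy hz
  have ha := hmem a (by simp)
  have hb := hmem b (by simp)
  have hc := hmem c (by simp)
  have e : ∀ x y z : ℕ, (∀ i, (i = x ∨ i = y ∨ i = z) ↔ (i = a ∨ i = b ∨ i = c)) →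
      ({x, y, z} : Finset ℕ) = {a, b, c} := fun x y z h => by ext i; simpa using h i
  -- Only decreasing triples are enumerated, so the three labels have to be sorted. Two of the eight
  -- sign patterns are cyclic and impossible.
  rcases lt_or_gt_of_ne hab with h1 | h1 <;> rcases lt_or_gt_of_ne hac with h2 | h2 <;>
    rcases lt_or_gt_of_ne hbc with h3 | h3
  · exact key c b a hc h3 h1 (e _ _ _ fun i => by tauto)
  · exact key b c a hb h3 h2 (e _ _ _ fun i => by tauto)
  · omega
  · exact key b a c hb h1 h2 (e _ _ _ fun i => by tauto)
  · exact key c a b hc h2 h1 (e _ _ _ fun i => by tauto)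
  · omega
  · exact key a c b ha h2 h3 (e _ _ _ fun i => by tauto)
  · exact key a b c ha h1 h3 (e _ _ _ fun i => by tauto)

/-! ### Soundness of the search for bad segments -/

section Soundness

variable {V : Type*} [DecidableEq V] (T : PartialSteinerTripleSystem V) (n : ℕ) (e : ℕ → V)

/-- With the labelling `e` of points, the mask `m` is a block. -/
def IsBlock (m : ℕ) : Prop := m < 2 ^ n ∧ (points n m).image e ∈ T.blocks

/-- No copy of the configuration `L` is contained in `T`. -/
def Refuted (L : List ℕ) : Prop := ∀ e : ℕ → V, Set.InjOn e (Set.Iio n) →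
  (∀ t ∈ L, ({e (digit t 0), e (digit t 1), e (digit t 2)} : Finset V) ∈ T.blocks) → False

variable {T n e}

theorem coe_points_subset (n m : ℕ) : (points n m : Set ℕ) ⊆ Set.Iio n :=
  fun _ hi => (mem_points.1 hi).1

theorem isBlock_tripleMask {f : ℕ → ℕ} {t : ℕ} (h : tripleMask f t < 2 ^ n) :
    IsBlock T n e (tripleMask f t) ↔
      ({e (f (digit t 0)), e (f (digit t 1)), e (f (digit t 2))} : Finset V) ∈ T.blocks := by
  rw [IsBlock, and_iff_right h, tripleMask, points_mask h]
  simp [Finset.image_insert]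

theorem image_points_inj {m m' : ℕ} (he : Set.InjOn e (Set.Iio n)) (hm : m < 2 ^ n)
    (hm' : m' < 2 ^ n) (h : (points n m).image e = (points n m').image e) : m = m' := by
  refine points_injective hm hm' (Finset.coe_injective ?_)
  refine (he.image_eq_image_iff (coe_points_subset n m) (coe_points_subset n m')).1 ?_
  simpa using congrArg (fun s : Finset V => (s : Set V)) h

/-- Two common bits are two common points, so the blocks coincide, and injectivity of the labelling
carries the equality back to the masks. -/
theorem IsBlock.compatible {p m : ℕ} (he : Set.InjOn e (Set.Iio n)) (hp : IsBlock T n e p)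
    (hm : IsBlock T n e m) : compatible p m = true := by
  rw [SequenceCertificate.compatible, either_eq, Bool.or_eq_true, beq_iff, beq_iff]
  by_contra hcon
  push Not at hcon
  obtain ⟨i, j, hij, hi, hj⟩ := exists_two_bits hcon.1
  have hland : Nat.land p m = p &&& m := rfl
  rw [hland, Nat.testBit_and, Bool.and_eq_true] at hi hj
  have hin := lt_of_testBit hp.1 hi.1
  have hjn := lt_of_testBit hp.1 hj.1
  exact hcon.2 (image_points_inj he hp.1 hm.1 (T.edge_disjoint _ hp.2 _ hm.2 (e i) (e j)
    (fun h => hij (he hin hjn h))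
    (Finset.mem_image_of_mem e (mem_points.2 ⟨hin, hi.1⟩))
    (Finset.mem_image_of_mem e (mem_points.2 ⟨hjn, hj.1⟩))
    (Finset.mem_image_of_mem e (mem_points.2 ⟨hin, hi.2⟩))
    (Finset.mem_image_of_mem e (mem_points.2 ⟨hjn, hj.2⟩))))

theorem IsBlock.card_points {m : ℕ} (he : Set.InjOn e (Set.Iio n)) (hm : IsBlock T n e m) :
    (points n m).card = 3 := by
  rw [← T.card_block _ hm.2, Finset.card_image_of_injOn (he.mono (coe_points_subset n m))]

theorem disjoint_image_points {m u : ℕ} (he : Set.InjOn e (Set.Iio n))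
    (h : Nat.land m u = 0) : Disjoint ((points n m).image e) ((points n u).image e) := by
  rw [Finset.disjoint_left]
  intro x hx hx'
  obtain ⟨i, hi, rfl⟩ := Finset.mem_image.1 hx
  obtain ⟨j, hj, hji⟩ := Finset.mem_image.1 hx'
  rw [mem_points] at hi hj
  obtain rfl := he hj.1 hi.1 hji
  rw [land_eq_zero_iff] at h
  simp [h _ hi.2] at hj

/-- `F` is the family collected so far and `u` a mask that covers it; being disjoint from `u` then
makes a new block disjoint from all of `F`. -/
theorem hasDisjoint_sound (he : Set.InjOn e (Set.Iio n)) (l : List ℕ)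
    (hl : ∀ m ∈ l, IsBlock T n e m) : ∀ (k u : ℕ) (F : Finset (Finset V)),
    hasDisjoint l k u = true → T.IsDisjointBlocks F → (∀ B ∈ F, B ⊆ (points n u).image e) →
    ∃ F', T.IsDisjointBlocks F' ∧ F'.card = F.card + k := by
  induction l with
  | nil =>
    intro k u F h hF _
    exact ⟨F, hF, by have := (beq_iff _ _).1 h; omega⟩
  | cons m l ih =>
    intro k u F h hF hFu
    replace h : either (Nat.beq k 0) (either (hasDisjoint l k u) (both (Nat.beq (Nat.land m u) 0)
      (hasDisjoint l (Nat.pred k) (Nat.lor u m)))) = true := h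
    rw [either_eq, either_eq, both_eq, Bool.or_eq_true, Bool.or_eq_true, Bool.and_eq_true,
      beq_iff, beq_iff] at h
    have hl' : ∀ m ∈ l, IsBlock T n e m := fun m hm => hl m (List.mem_cons_of_mem _ hm)
    rcases h with rfl | h | ⟨h0, h⟩
    · exact ⟨F, hF, rfl⟩
    · exact ih hl' k u F h hF hFu
    -- For `k = 0` nothing remains to be found; otherwise `Nat.pred k` is a true predecessor and the
    -- count comes out right.
    · rcases Nat.eq_zero_or_pos k with rfl | hk
      · exact ⟨F, hF, rfl⟩
      have hm := hl m List.mem_cons_self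
      have hdis : ∀ B ∈ F, Disjoint ((points n m).image e) B := fun B hB =>
        (disjoint_image_points he h0).mono_right (hFu B hB)
      have hne : ((points n m).image e).Nonempty := by
        rw [← Finset.card_pos, T.card_block _ hm.2]; norm_num
      have hnot : (points n m).image e ∉ F := fun hB =>
        hne.ne_empty (Finset.disjoint_self_iff_empty _ |>.1 (hdis _ hB))
      have hor : Nat.lor u m = u ||| m := rfl
      have hF2 : T.IsDisjointBlocks (insert ((points n m).image e) F) := by
        refine ⟨fun B hB => ?_, fun B hB C hC hBC => ?_⟩
        · rcases Finset.mem_insert.1 hB with rfl | hB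
          · exact hm.2
          · exact hF.1 B hB
        · rcases Finset.mem_insert.1 hB with rfl | hB <;>
            rcases Finset.mem_insert.1 hC with rfl | hC
          · exact absurd rfl hBC
          · exact hdis C hC
          · exact (hdis B hB).symm
          · exact hF.2 B hB C hC hBC
      have hFu2 : ∀ B ∈ insert ((points n m).image e) F, B ⊆ (points n (Nat.lor u m)).image e := by
        intro B hB x hx
        rcases Finset.mem_insert.1 hB with rfl | hB
        · obtain ⟨i, hi, rfl⟩ := Finset.mem_image.1 hx
          rw [mem_points] at hi
          exact Finset.mem_image_of_mem e (mem_points.2 ⟨hi.1, by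
            rw [hor, Nat.testBit_or, hi.2, Bool.or_true]⟩)
        · obtain ⟨i, hi, rfl⟩ := Finset.mem_image.1 (hFu B hB hx)
          rw [mem_points] at hi
          exact Finset.mem_image_of_mem e (mem_points.2 ⟨hi.1, by
            rw [hor, Nat.testBit_or, hi.2, Bool.true_or]⟩)
      obtain ⟨F', hF', hcard⟩ := ih hl' (Nat.pred k) (Nat.lor u m) _ h hF2 hFu2
      refine ⟨F', hF', ?_⟩
      rw [hcard, Finset.card_insert_of_notMem hnot, Nat.pred_eq_sub_one]
      omega

/-! ### Actual blocks survive the pruning -/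

variable {K : ℕ} {pos : List ℕ} {nogoods : List (List ℕ)}

theorem conflict_eq_false (hK : T.AtMostDisjointBlocks K) (he : Set.InjOn e (Set.Iio n))
    (hpos : ∀ m ∈ pos, IsBlock T n e m) (hng : ∀ g ∈ nogoods, ¬ ∀ m ∈ g, IsBlock T n e m)
    {m : ℕ} {new : List ℕ} (hm : IsBlock T n e m) (hnew : ∀ m ∈ new, IsBlock T n e m) :
    conflict K pos nogoods m new = false := by
  rw [Bool.eq_false_iff]
  intro h
  rw [conflict, either_eq, Bool.or_eq_true] at h
  rcases h with h | h
  · rw [forSome_eq, List.any_eq_true] at h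
    obtain ⟨g, hg, hall⟩ := h
    rw [forAll_eq, List.all_eq_true] at hall
    refine hng g hg fun x hx => ?_
    have := (mem_iff _ _).1 (hall x hx)
    rcases List.mem_cons.1 this with rfl | hx'
    · exact hm
    · exact hnew x hx'
  -- The family starts with the block of `m` itself, so `K` further blocks exceed the maximum.
  · obtain ⟨F', hF', hcard⟩ := hasDisjoint_sound he (new ++ pos) (fun x hx =>
      (List.mem_append.1 hx).elim (hnew x) (hpos x)) K m {(points n m).image e} h
      ⟨by simpa using hm.2, by simp +contextual⟩ (by simp)
    have := hK F' hF'
    rw [hcard, Finset.card_singleton] at this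
    omega

theorem IsBlock.mem_candidates (hK : T.AtMostDisjointBlocks K) (he : Set.InjOn e (Set.Iio n))
    (hpos : ∀ m ∈ pos, IsBlock T n e m) (hng : ∀ g ∈ nogoods, ¬ ∀ m ∈ g, IsBlock T n e m)
    {m : ℕ} (hm : IsBlock T n e m) : m ∈ candidates n K pos nogoods := by
  rw [candidates, mem_sieve, both_eq, Bool.and_eq_true, forAll_eq, List.all_eq_true,
    conflict_eq_false hK he hpos hng hm (by simp)]
  exact ⟨mem_triples_of_card hm.1 (hm.card_points he),
    fun p hp => (hpos p hp).compatible he hm, rfl⟩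

/-- `S` is the part of a hypothetical partition still to be met in `l`, and the induction follows
the branch given by whether `m ∈ S`. Disjointness from `m` keeps the rest of `S` inside `w` with `m`
removed; a true conflict cannot have cut the branch. -/
theorem noPartition_sound (hK : T.AtMostDisjointBlocks K) (he : Set.InjOn e (Set.Iio n))
    (hpos : ∀ m ∈ pos, IsBlock T n e m) (hng : ∀ g ∈ nogoods, ¬ ∀ m ∈ g, IsBlock T n e m)
    (l : List ℕ) : ∀ (j w : ℕ) (new : List ℕ) (S : Finset ℕ),
    noPartition K pos nogoods l j w new = true → (∀ m ∈ new, IsBlock T n e m) →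
    (∀ m ∈ S, m ∈ l ∧ IsBlock T n e m ∧ Nat.land m w = m) →
    (∀ m ∈ S, ∀ m' ∈ S, m ≠ m' → Nat.land m m' = 0) → S.card ≠ j := by
  induction l with
  | nil =>
    intro j w new S h _ hS _ hcard
    have h0 : S = ∅ := Finset.eq_empty_of_forall_notMem fun m hm => by simpa using (hS m hm).1
    subst h0
    rw [Finset.card_empty] at hcard
    subst hcard
    exact absurd (show Nat.blt 0 0 = true from h) (by decide)
  | cons m l ih =>
    intro j w new S h hnew hS hdis hcard
    replace h : both (Nat.blt 0 j) (both
      (Bool.rec true (either (noPartition K pos nogoods l (Nat.pred j) (Nat.xor w m) (m :: new))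
        (conflict K pos nogoods m new)) (Nat.beq (Nat.land m w) m))
      (noPartition K pos nogoods l j w new)) = true := h
    rw [both_eq, both_eq, Bool.and_eq_true, Bool.and_eq_true] at h
    obtain ⟨-, h1, h2⟩ := h
    by_cases hm : m ∈ S
    · obtain ⟨-, hb, hw⟩ := hS m hm
      rw [(beq_iff _ _).2 hw] at h1
      replace h1 : either (noPartition K pos nogoods l (Nat.pred j) (Nat.xor w m) (m :: new))
        (conflict K pos nogoods m new) = true := h1
      rw [either_eq, conflict_eq_false hK he hpos hng hb hnew, Bool.or_false] at h1
      refine ih _ _ _ (S.erase m) h1 ?_ ?_ ?_ ?_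
      · intro x hx
        rcases List.mem_cons.1 hx with rfl | hx
        exacts [hb, hnew x hx]
      · intro x hx
        obtain ⟨hxm, hxS⟩ := Finset.mem_erase.1 hx
        obtain ⟨hl, hxb, hxw⟩ := hS x hxS
        refine ⟨(List.mem_cons.1 hl).resolve_left hxm, hxb, ?_⟩
        have hd := hdis x hxS m hm hxm
        rw [land_eq_left_iff] at hxw ⊢
        rw [land_eq_zero_iff] at hd
        intro i hi
        have hxor : Nat.xor w m = w ^^^ m := rfl
        rw [hxor, Nat.testBit_xor, hxw i hi, hd i hi]
        rfl
      · exact fun x hx y hy => hdis x (Finset.mem_of_mem_erase hx) y (Finset.mem_of_mem_erase hy)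
      · rw [Finset.card_erase_of_mem hm, hcard, Nat.pred_eq_sub_one]
    · refine ih _ _ _ S h2 hnew (fun x hx => ?_) hdis hcard
      obtain ⟨hl, hx'⟩ := hS x hx
      exact ⟨(List.mem_cons.1 hl).resolve_left (fun h => hm (h ▸ hx)), hx'⟩

/-- A partition of the segment into blocks is turned into one of its labels into masks, which the
search would have found unless the segment was exempt. -/
theorem noBadSegment_sound (hK : T.AtMostDisjointBlocks K) (he : Set.InjOn e (Set.Iio n))
    (hpos : ∀ m ∈ pos, IsBlock T n e m) (hng : ∀ g ∈ nogoods, ¬ ∀ m ∈ g, IsBlock T n e m)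
    {p : List ℕ} (hp : ∀ i ∈ p, i < n) (h : noBadSegment n K pos nogoods p = true)
    {w : List ℕ} (hw : w <:+: p) {S : Finset (Finset V)} (hS : T.IsDisjointBlocks S)
    (hSw : S.biUnion id = (w.map e).toFinset) (hS0 : S.card ≠ 0) (hwl : w.length = 3 * S.card) :
    n = 3 * S.card := by
  have hSK := hK S hS
  obtain ⟨x, y, hxy⟩ := hw
  set t := w ++ y with ht
  have htp : t ∈ p.tails := by
    rw [List.mem_tails]
    exact ⟨x, by rw [← hxy, ht, List.append_assoc]⟩
  obtain ⟨j, hj⟩ := Nat.exists_eq_succ_of_ne_zero hS0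
  rw [noBadSegment, forAll_eq, List.all_eq_true] at h
  have h1 := h t htp
  rw [forAll_eq, List.all_eq_true] at h1
  have h2 := h1 j (List.mem_range.2 (by omega))
  rw [either_eq, Bool.or_eq_true, beq_iff] at h2
  have hmul : Nat.mul 3 (Nat.succ j) = 3 * S.card := by rw [hj]; rfl
  have hmulK : Nat.mul 3 K = 3 * K := rfl
  rw [hmul, hmulK] at h2
  rcases h2 with h2 | h2
  swap
  · exact h2
  exfalso
  have htake : t.take (3 * S.card) = w := by rw [ht, ← hwl, List.take_left]
  have hwn : ∀ i ∈ w, i < n := fun i hi => hp i (by rw [← hxy]; simp [hi])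
  -- the mask of a subset of the segment
  set M : Finset V → ℕ := fun B => listMask (w.filter fun i => e i ∈ B) with hM
  have hbit : ∀ B i, (M B).testBit i = true ↔ i ∈ w ∧ e i ∈ B := fun B i => by
    simp [hM, testBit_listMask]
  have himg : ∀ B ∈ S, (points n (M B)).image e = B := by
    intro B hB
    ext v
    simp only [Finset.mem_image, mem_points, hbit]
    constructor
    · rintro ⟨i, ⟨-, -, hi⟩, rfl⟩; exact hi
    · intro hv
      have : v ∈ (w.map e).toFinset := hSw ▸ Finset.mem_biUnion.2 ⟨B, hB, hv⟩
      obtain ⟨i, hi, rfl⟩ := List.mem_map.1 (List.mem_toFinset.1 this)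
      exact ⟨i, ⟨hwn i hi, hi, hv⟩, rfl⟩
  have hblock : ∀ B ∈ S, IsBlock T n e (M B) := fun B hB =>
    ⟨lt_two_pow_of_testBit fun i hi => hwn i ((hbit B i).1 hi).1, by
      rw [himg B hB]; exact hS.1 B hB⟩
  refine noPartition_sound hK he hpos hng _ _ _ _ (S.image M) h2 (by simp) ?_ ?_ ?_
  · intro m hm
    obtain ⟨B, hB, rfl⟩ := Finset.mem_image.1 hm
    refine ⟨?_, hblock B hB, ?_⟩
    · rw [mem_sieve, beq_iff, land_eq_left_iff]
      refine ⟨(hblock B hB).mem_candidates hK he hpos hng, fun i hi => ?_⟩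
      rw [testBit_listMask]
      have hiw := ((hbit B i).1 hi).1
      rw [← htake] at hiw
      exact (List.take_subset_take_left t (by omega)) hiw
    · rw [land_eq_left_iff]
      intro i hi
      rw [testBit_listMask, htake]
      exact ((hbit B i).1 hi).1
  · intro m hm m' hm' hne
    obtain ⟨B, hB, rfl⟩ := Finset.mem_image.1 hm
    obtain ⟨C, hC, rfl⟩ := Finset.mem_image.1 hm'
    have hBC : B ≠ C := fun h => hne (by rw [h])
    rw [land_eq_zero_iff]
    intro i hi
    rw [Bool.eq_false_iff]
    intro hi'
    exact Finset.disjoint_left.1 (hS.2 B hB C hC hBC) ((hbit B i).1 hi).2 ((hbit C i).1 hi').2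
  · rw [Finset.card_image_of_injOn, hj]
    intro B hB C hC hBC
    have hBC' : M B = M C := hBC
    rw [← himg B hB, ← himg C hC, hBC']

end Soundness

/-! ### Segments of a list with inserted points -/

/-- Entries of a segment are consecutive, so it cannot pass over `r` without containing it. -/
theorem infix_of_notMem {α : Type*} {s B : List α} {r : α} (hr : r ∉ s) :
    ∀ {A : List α}, s <:+: A ++ r :: B → s <:+: A ∨ s <:+: B := by
  have hpre : ∀ A : List α, s <+: A ++ r :: B → s <+: A := by
    intro A h
    rcases le_total s.length A.length with hl | hl
    · exact List.prefix_of_prefix_length_le h (List.prefix_append _ _) hl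
    · rcases hl.eq_or_lt with hl | hl
      · exact List.prefix_of_prefix_length_le h (List.prefix_append _ _) hl.ge
      · have : A ++ [r] <+: s := by
          refine List.prefix_of_prefix_length_le ⟨B, by simp⟩ h ?_
          simpa using hl
        exact absurd (this.subset (by simp)) hr
  intro A h
  induction A with
  | nil =>
    rw [List.nil_append, List.infix_cons_iff] at h
    rcases h with h | h
    · exact Or.inl (hpre [] h).isInfix
    · exact Or.inr h
  | cons a A ih =>
    rw [List.cons_append, List.infix_cons_iff] at h
    rcases h with h | h
    · exact Or.inl (hpre (a :: A) h).isInfix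
    · exact (ih h).imp_left fun h => h.trans (List.suffix_cons a A).isInfix

/-- `R` must be nonempty: otherwise a segment may straddle the junction of `A` and `B`. -/
theorem infix_of_disjoint_middle {α : Type*} {s A R B : List α} (hR : ∀ r ∈ R, r ∉ s)
    (hR0 : R ≠ []) (h : s <:+: A ++ R ++ B) : s <:+: A ∨ s <:+: B := by
  induction R generalizing A with
  | nil => exact absurd rfl hR0
  | cons r R ih =>
    rw [List.append_assoc, List.cons_append] at h
    rcases infix_of_notMem (hR r (by simp)) h with h | h
    · exact Or.inl h
    · rcases eq_or_ne R [] with rfl | hR1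
      · exact Or.inr h
      · refine (ih (A := []) (fun x hx => hR x (by simp [hx])) hR1 (by simpa using h)).imp_left ?_
        intro h
        rw [List.infix_nil.1 h]
        exact List.nil_infix

/-- Cut both the segment and the whole list at `r`. Since `r` occurs only once, the cuts agree: the
`a` entries before `r` end the part before the cut, and those outside `R` are among the last `a` of
`A`. The other side is symmetric. -/
theorem infix_meets_middle {α : Type*} {s A R B : List α} {r : α} (hrs : r ∈ s) (hrR : r ∈ R)
    (hnd : (A ++ R ++ B).Nodup) (h : s <:+: A ++ R ++ B) :
    ∃ a b, a + b + 1 = s.length ∧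
      ∀ z ∈ s, z ∈ R ∨ z ∈ A.drop (A.length - a) ∨ z ∈ B.take b := by
  obtain ⟨s1, s2, rfl⟩ := List.append_of_mem hrs
  obtain ⟨R1, R2, rfl⟩ := List.append_of_mem hrR
  obtain ⟨x, y, hxy⟩ := h
  have heq : (A ++ R1) ++ r :: (R2 ++ B) = (x ++ s1) ++ r :: (s2 ++ y) := by
    simpa using hxy.symm
  have hnd' : ((A ++ R1) ++ r :: (R2 ++ B)).Nodup := by simpa using hnd
  have hnd2 := hnd'
  rw [heq] at hnd2
  have hmid : ∀ {L L' : List α}, (L ++ r :: L').Nodup → r ∉ L := by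
    intro L L' h hr
    rw [List.nodup_append] at h
    exact h.2.2 r hr r (by simp) rfl
  have hmid' : ∀ {L L' : List α}, (L ++ r :: L').Nodup → r ∉ L' := by
    intro L L' h hr
    rw [List.nodup_append] at h
    exact (List.nodup_cons.1 h.2.1).1 hr
  obtain ⟨h1, -, h2⟩ := 
    (List.append_cons_inj_of_notMem (hmid hnd2) (hmid' hnd2)).1 heq.symm
  refine ⟨s1.length, s2.length, by simp; omega, fun z hz => ?_⟩
  have hleft : z ∈ s1 → z ∈ R1 ∨ z ∈ A.drop (A.length - s1.length) := by
    intro hz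
    rcases List.append_eq_append_iff.1 h1 with ⟨c, hA, hs⟩ | ⟨c, hx, hs⟩
    · rw [hs] at hz
      rcases List.mem_append.1 hz with hz | hz
      · right
        have hlen : A.length - s1.length ≤ x.length := by rw [hA, hs]; simp
        rw [hA] at hlen ⊢
        rw [List.drop_append_of_le_length hlen]
        exact List.mem_append_right _ hz
      · exact Or.inl hz
    · exact Or.inl (by rw [hs]; simp [hz])
  have hright : z ∈ s2 → z ∈ R2 ∨ z ∈ B.take s2.length := by
    intro hz
    rcases List.append_eq_append_iff.1 h2 with ⟨c, hA, hs⟩ | ⟨c, hx, hs⟩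
    · exact Or.inl (by rw [hA]; simp [hz])
    · rw [hx] at hz
      rcases List.mem_append.1 hz with hz | hz
      · exact Or.inl hz
      · right
        have hc : c = B.take c.length := by rw [hs, List.take_left]
        rw [hc] at hz
        exact List.take_subset_take_left B (by rw [hx]; simp) hz
  rcases List.mem_append.1 hz with hz | hz
  · rcases hleft hz with h | h
    · exact Or.inl (by simp [h])
    · exact Or.inr (Or.inl h)
  · rcases List.mem_cons.1 hz with rfl | hz
    · exact Or.inl (by simp)
    · rcases hright hz with h | h
      · exact Or.inl (by simp [h])
      · exact Or.inr (Or.inr h)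

/-! ### Soundness of certificates -/

section Soundness

variable {V : Type*} [DecidableEq V] {T : PartialSteinerTripleSystem V} {n K : ℕ} {e : ℕ → V}

/-! ### Base triples and excluded configurations -/

/-- Digits are read from the right, so a literal such as `0x012` yields its labels in reverse. -/
theorem triple_reverse (e : ℕ → V) (a b c : ℕ) :
    ({e c, e b, e a} : Finset V) = {e a, e b, e c} := by
  ext x
  simp only [Finset.mem_insert, Finset.mem_singleton]
  tauto

theorem exists_baseTriple (hK : K ≤ 3) {i : ℕ} (hi : i < K) : ∃ t ∈ baseTriples K,
    ∀ e : ℕ → V, ({e (digit t 0), e (digit t 1), e (digit t 2)} : Finset V) =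
      {e (3 * i), e (3 * i + 1), e (3 * i + 2)} := by
  have hi3 : i < 3 := by omega
  interval_cases i
  · exact ⟨0x012, by interval_cases K <;> decide, fun e => triple_reverse e 0 1 2⟩
  · exact ⟨0x345, by interval_cases K <;> decide, fun e => triple_reverse e 3 4 5⟩
  · exact ⟨0x678, by interval_cases K; decide, fun e => triple_reverse e 6 7 8⟩

theorem exists_of_mem_baseTriples (hK : K ≤ 3) {t : ℕ} (ht : t ∈ baseTriples K) : ∃ i < K,
    ∀ e : ℕ → V, ({e (digit t 0), e (digit t 1), e (digit t 2)} : Finset V) =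
      {e (3 * i), e (3 * i + 1), e (3 * i + 2)} := by
  have h : t = 0x012 ∧ 0 < K ∨ t = 0x345 ∧ 1 < K ∨ t = 0x678 ∧ 2 < K := by
    interval_cases K <;> simp [baseTriples] at ht ⊢ <;> tauto
  rcases h with ⟨rfl, h⟩ | ⟨rfl, h⟩ | ⟨rfl, h⟩
  · exact ⟨0, h, fun e => triple_reverse e 0 1 2⟩
  · exact ⟨1, h, fun e => triple_reverse e 3 4 5⟩
  · exact ⟨2, h, fun e => triple_reverse e 6 7 8⟩

theorem card_of_isDisjointBlocks {S : Finset (Finset V)} (hS : T.IsDisjointBlocks S) :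
    (S.biUnion id).card = 3 * S.card := by
  rw [Finset.card_biUnion (t := id) hS.2, Finset.sum_congr rfl fun B hB =>
    (T.card_block B (hS.1 B hB) : (id B).card = 3)]
  simp [mul_comm]

/-- `Refuted` speaks of all labellings, in particular of `e` composed with the permutation `σ`; for
it, the blocks in `g` together with those in `pos` would complete a refuted configuration. -/
theorem not_forall_mem_nogoods {prev : List (List ℕ)} (hprev : ∀ L ∈ prev, Refuted T n L)
    (he : Set.InjOn e (Set.Iio n)) {pos : List ℕ} (hpos : ∀ m ∈ pos, IsBlock T n e m)
    (excluded : List (ℕ × ℕ)) : ∀ g ∈ excluded.flatMap (nogoodsOf n pos prev),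
      ¬ ∀ m ∈ g, IsBlock T n e m := by
  intro g hg hall
  obtain ⟨⟨i, σ⟩, -, hg⟩ := List.mem_flatMap.1 hg
  rw [nogoodsOf] at hg
  cases hL : prev[i]? with
  | none => simp [hL] at hg
  | some L =>
    simp only [hL] at hg
    split_ifs at hg with hσ
    · rw [List.mem_singleton] at hg
      subst hg
      refine hprev L (List.mem_of_getElem? hL) (e ∘ digit σ) ?_ ?_
      · exact he.comp (digit_injOn hσ) fun i hi => digit_lt hσ hi
      · intro t ht
        have hb : IsBlock T n e (tripleMask (digit σ) t) := by
          by_cases hm : tripleMask (digit σ) t ∈ pos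
          · exact hpos _ hm
          · refine hall _ ((mem_sieve _ _ _).2 ⟨List.mem_map.2 ⟨t, ht, rfl⟩, ?_⟩)
            have : mem (tripleMask (digit σ) t) pos = false := by
              rw [Bool.eq_false_iff, Ne, mem_iff]; exact hm
            rw [this]
        exact (isBlock_tripleMask hb.1).1 hb
    · simp at hg

/-- A segment that meets few base triples cannot be partitioned into many blocks. -/
theorem card_le_of_few_base (hK : T.AtMostDisjointBlocks K) (he : Set.InjOn e (Set.Iio n))
    (hn : 3 * K ≤ n)
    (hbase : ∀ i < K, ({e (3 * i), e (3 * i + 1), e (3 * i + 2)} : Finset V) ∈ T.blocks)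
    {S : Finset (Finset V)} (hS : T.IsDisjointBlocks S) (D : Finset ℕ) (hD : ∀ i ∈ D, i < K)
    (hSD : ∀ x ∈ S.biUnion id, ∀ m < n, e m = x → m / 3 ∉ D) : S.card + D.card ≤ K := by
  set b : ℕ → Finset V := fun i => {e (3 * i), e (3 * i + 1), e (3 * i + 2)} with hb
  have hmem : ∀ i < K, ∀ x ∈ b i, ∃ m < n, e m = x ∧ m / 3 = i := by
    intro i hi x hx
    simp only [hb, Finset.mem_insert, Finset.mem_singleton] at hx
    rcases hx with rfl | rfl | rfl
    · exact ⟨_, by omega, rfl, by omega⟩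
    · exact ⟨_, by omega, rfl, by omega⟩
    · exact ⟨_, by omega, rfl, by omega⟩
  have hbb : ∀ i < K, ∀ j < K, i ≠ j → Disjoint (b i) (b j) := by
    intro i hi j hj hij
    rw [Finset.disjoint_left]
    intro x hx hx'
    obtain ⟨m, hm, hmx, hmi⟩ := hmem i hi x hx
    obtain ⟨m', hm', hmx', hmj⟩ := hmem j hj x hx'
    have := he hm hm' (hmx.trans hmx'.symm)
    omega
  have hSb : ∀ B ∈ S, ∀ i ∈ D, Disjoint B (b i) := by
    intro B hB i hi
    rw [Finset.disjoint_left]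
    intro x hx hx'
    obtain ⟨m, hm, hmx, hmi⟩ := hmem i (hD i hi) x hx'
    exact hSD x (Finset.mem_biUnion.2 ⟨B, hB, hx⟩) m hm hmx (hmi ▸ hi)
  have hinj : Set.InjOn b D := by
    intro i hi j hj hij
    by_contra hne
    have := hbb i (hD i hi) j (hD j hj) hne
    rw [hij, Finset.disjoint_self_iff_empty] at this
    exact Finset.insert_ne_empty _ _ this
  have hdisj : Disjoint S (D.image b) := by
    rw [Finset.disjoint_left]
    intro B hB hB'
    obtain ⟨i, hi, rfl⟩ := Finset.mem_image.1 hB'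
    have := hSb _ hB i hi
    rw [Finset.disjoint_self_iff_empty] at this
    exact Finset.insert_ne_empty _ _ this
  -- The base triples indexed by `D` can be adjoined to `S`, since `S` avoids their points.
  have hle := hK (S ∪ D.image b) ⟨?_, ?_⟩
  · rwa [Finset.card_union_of_disjoint hdisj, Finset.card_image_of_injOn hinj] at hle
  · intro B hB
    rcases Finset.mem_union.1 hB with hB | hB
    · exact hS.1 B hB
    · obtain ⟨i, hi, rfl⟩ := Finset.mem_image.1 hB
      exact hbase i (hD i hi)
  · intro B hB C hC hBC
    rcases Finset.mem_union.1 hB with hB | hB <;> rcases Finset.mem_union.1 hC with hC | hC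
    · exact hS.2 B hB C hC hBC
    · obtain ⟨i, hi, rfl⟩ := Finset.mem_image.1 hC
      exact hSb B hB i hi
    · obtain ⟨i, hi, rfl⟩ := Finset.mem_image.1 hB
      exact (hSb C hC i hi).symm
    · obtain ⟨i, hi, rfl⟩ := Finset.mem_image.1 hB
      obtain ⟨j, hj, rfl⟩ := Finset.mem_image.1 hC
      exact hbb i (hD i hi) j (hD j hj) fun h => hBC (by rw [h])

end Soundness

/-- The triples are written one after the other. All indices used are in range, so the default `d`
never matters. -/
theorem exists_list_of_disjoint_triples {V : Type*} [DecidableEq V] (d : V) (Bs : List (Finset V))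
    (h3 : ∀ B ∈ Bs, B.card = 3) (hd : Bs.Pairwise Disjoint) :
    ∃ l : List V, l.Nodup ∧ l.length = 3 * Bs.length ∧ (∀ x ∈ l, ∃ B ∈ Bs, x ∈ B) ∧
      ∀ i < Bs.length, ({l.getD (3 * i) d, l.getD (3 * i + 1) d, l.getD (3 * i + 2) d} :
        Finset V) ∈ Bs := by
  induction Bs with
  | nil => exact ⟨[], by simp⟩
  | cons B Bs ih =>
    rw [List.pairwise_cons] at hd
    obtain ⟨l, hnd, hlen, hmem, hi⟩ := ih (fun C hC => h3 C (by simp [hC])) hd.2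
    obtain ⟨a, b, c, hab, hac, hbc, rfl⟩ := Finset.card_eq_three.1 (h3 B (by simp))
    have hnot : ∀ x ∈ ({a, b, c} : Finset V), x ∉ l := by
      intro x hx hxl
      obtain ⟨C, hC, hxC⟩ := hmem x hxl
      exact Finset.disjoint_left.1 (hd.1 C hC) hx hxC
    refine ⟨a :: b :: c :: l, ?_, by simp [hlen]; ring, ?_, ?_⟩
    · have h1 := hnot a (by simp)
      have h2 := hnot b (by simp)
      have h3 := hnot c (by simp)
      simp [*]
    · intro x hx
      simp only [List.mem_cons] at hx
      rcases hx with rfl | rfl | rfl | hx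
      · exact ⟨_, List.mem_cons_self, by simp⟩
      · exact ⟨_, List.mem_cons_self, by simp⟩
      · exact ⟨_, List.mem_cons_self, by simp⟩
      · obtain ⟨C, hC, hxC⟩ := hmem x hx
        exact ⟨C, List.mem_cons_of_mem _ hC, hxC⟩
    · intro i hil
      cases i with
      | zero => simp
      | succ i =>
        have := hi i (by simpa using hil)
        rw [show 3 * (i + 1) = 3 * i + 1 + 1 + 1 by ring]
        simp only [List.getD_cons_succ]
        exact List.mem_cons_of_mem _ this

/-! ### From certificates to sequenceability -/

section Soundness

variable {V : Type*} [DecidableEq V] [Fintype V] {T : PartialSteinerTripleSystem V} {n K : ℕ}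

/-- Given a copy of the configuration, order the points as `P`, then the unlabelled points `R` in
any order, then `Q`. As the system is not sequenceable, some proper segment `w` splits into a family
`S` of blocks. If `w` meets `R`, it misses too many base triples; if not, it is a segment of the
labelled sequence, and the search leaves only the full sequence. -/
theorem stepValid_sound (hK3 : K ≤ 3) (hK : T.AtMostDisjointBlocks K) (hT : ¬ T.Sequenceable)
    {ext : Bool} (hext : ext = false → n = Fintype.card V)
    {prev : List (List ℕ)} (hprev : ∀ L ∈ prev, Refuted T n L) {s : Step}
    (h : stepValid n K ext prev s = true) : Refuted T n s.blocks := by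
  intro e he hblocks
  rw [stepValid, Bool.and_eq_true, Bool.and_eq_true, Bool.and_eq_true] at h
  obtain ⟨⟨⟨hp, hlt⟩, hseg⟩, hgap⟩ := h
  set pos := s.blocks.map (tripleMask id) with hpos_def
  have hpos : ∀ m ∈ pos, IsBlock T n e m := by
    intro m hm
    have hmn : m < 2 ^ n := Nat.le_of_ble_eq_true (List.all_eq_true.1 hlt m hm)
    obtain ⟨t, ht, rfl⟩ := List.mem_map.1 hm
    exact (isBlock_tripleMask hmn).2 (hblocks t ht)
  have hng := not_forall_mem_nogoods hprev he hpos s.excluded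
  set p := digits n s.seq with hp_def
  have hpmem := (coversRange_iff n p).1 hp
  have hpnd : p.Nodup := nodup_of_coversRange hp (length_digits n s.seq)
  set P := p.take s.gap
  set Q := p.drop s.gap
  have hPQ : P ++ Q = p := List.take_append_drop _ _
  set I : Finset V := (Finset.range n).image e with hI
  have hIcard : I.card = n := by
    rw [hI, Finset.card_image_of_injOn (by simpa [Set.Iio_def] using he), Finset.card_range]
  set R := (Finset.univ \ I).toList with hR
  have hRmem : ∀ x, x ∈ R ↔ ∀ i < n, e i ≠ x := by
    intro x
    simp [hR, hI]
  have hperm : (P.map e ++ R ++ Q.map e).Perm (p.map e ++ R) := by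
    rw [← hPQ, List.map_append, List.append_assoc, List.append_assoc]
    exact List.Perm.append_left _ List.perm_append_comm
  have hnd : (P.map e ++ R ++ Q.map e).Nodup := by
    rw [hperm.nodup_iff, List.nodup_append]
    refine ⟨hpnd.map_on fun x hx y hy => he ((hpmem x).1 hx) ((hpmem y).1 hy),
      Finset.nodup_toList _, ?_⟩
    rintro x hx y hy rfl
    obtain ⟨i, hi, rfl⟩ := List.mem_map.1 hx
    exact (hRmem _).1 hy i ((hpmem i).1 hi) rfl
  have hcomplete : ∀ x : V, x ∈ P.map e ++ R ++ Q.map e := by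
    intro x
    rw [hperm.mem_iff, List.mem_append, hRmem, List.mem_map]
    by_contra! hcon
    obtain ⟨i, hi, hix⟩ := hcon.2
    exact hcon.1 i ((hpmem i).2 hi) hix
  have hRnil : ext = false → R = [] := by
    intro hx
    rw [hR, Finset.toList_eq_nil, Finset.sdiff_eq_empty_iff_subset]
    rw [Finset.eq_univ_of_card I (by rw [hIcard, hext hx])]
  refine hT ⟨_, hnd, hcomplete, ?_⟩
  rintro w ⟨hw, hw0, hwne⟩ ⟨S, hS, hSw⟩
  have hwnd : w.Nodup := hnd.sublist hw.sublist
  have hwlen : w.length = 3 * S.card := by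
    rw [← card_of_isDisjointBlocks hS, hSw, List.toFinset_card_of_nodup hwnd]
  have hS0 : S.card ≠ 0 := by
    intro h0
    rw [h0, mul_zero, List.length_eq_zero_iff] at hwlen
    exact hw0 hwlen
  have hSK := hK S hS
  by_cases hmeet : ∃ r ∈ R, r ∈ w
  · obtain ⟨r, hrR, hrw⟩ := hmeet
    have hx : ext = true := by
      by_contra hx
      rw [hRnil (by simpa using hx)] at hrR
      simp at hrR
    rw [hx, Bool.not_true, Bool.false_or, Bool.and_eq_true, Bool.and_eq_true] at hgap
    obtain ⟨⟨hKn, hbase⟩, hexten⟩ := hgap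
    have hKn' : 3 * K + 1 ≤ n := Nat.le_of_ble_eq_true hKn
    obtain ⟨a, b, hab, hz⟩ := infix_meets_middle hrw hrR hnd hw
    obtain ⟨j, hj⟩ := Nat.exists_eq_succ_of_ne_zero hS0
    have h1 := List.all_eq_true.1 (List.all_eq_true.1 hexten j (List.mem_range.2 (by omega))) a
      (List.mem_range.2 (by omega))
    have h2 := Nat.le_of_ble_eq_true h1
    rw [show 3 * j + 2 - a = b by omega] at h2
    set good : ℕ → Bool := fun i =>
      (P.drop (P.length - a) ++ Q.take b).all fun x => !(Nat.beq (x / 3) i) with hgood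
    have hcount : (List.range K).countP good = ((Finset.range K).filter fun i => good i).card := by
      rw [List.countP_eq_length_filter,
        ← List.toFinset_card_of_nodup (List.nodup_range.filter _)]
      congr 1
      ext i
      simp
    rw [hcount] at h2
    have := card_le_of_few_base hK he (by omega) ?_ hS
      ((Finset.range K).filter fun i => good i) (fun i hi => by simp at hi; exact hi.1) ?_
    · omega
    · intro i hi
      obtain ⟨t, ht, hte⟩ := exists_baseTriple (V := V) hK3 hi
      rw [← hte]
      exact hblocks t ((mem_iff _ _).1 (List.all_eq_true.1 hbase t ht))
    · intro x hx m hm hmx hmem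
      have hxw : x ∈ w := by rw [hSw] at hx; simpa using hx
      have hg : good (m / 3) = true := (Finset.mem_filter.1 hmem).2
      rw [hgood, List.all_eq_true] at hg
      have hlab : ∀ L : List ℕ, L ⊆ p → x ∈ L.map e → m ∈ L := by
        intro L hL hxL
        obtain ⟨i, hi, hix⟩ := List.mem_map.1 hxL
        rwa [← he ((hpmem i).1 (hL hi)) hm (hix.trans hmx.symm)]
      have hmL : m ∈ P.drop (P.length - a) ++ Q.take b := by
        rw [List.mem_append]
        rcases hz x hxw with h | h | h
        · exact absurd hmx ((hRmem x).1 h m hm)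
        · left
          rw [List.length_map, ← List.map_drop] at h
          exact hlab _ (fun i hi => List.mem_of_mem_take (List.mem_of_mem_drop hi)) h
        · right
          rw [← List.map_take] at h
          exact hlab _ (fun i hi => List.mem_of_mem_drop (List.mem_of_mem_take hi)) h
      have := hg m hmL
      simp at this
  · push Not at hmeet
    have hwp : w <:+: p.map e := by
      rw [← hPQ, List.map_append]
      -- With nothing in the gap a segment may run across it, which is why `p` is checked as a whole
      -- and not `P` and `Q` separately.
      rcases eq_or_ne R [] with hR0 | hR0
      · simpa [hR0] using hw
      · rcases infix_of_disjoint_middle hmeet hR0 hw with h | h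
        · exact h.trans (List.prefix_append _ _).isInfix
        · exact h.trans (List.suffix_append _ _).isInfix
    obtain ⟨x, y, hxy⟩ := hwp
    obtain ⟨xw', y', hp1, hxw, -⟩ := List.map_eq_append_iff.1 hxy.symm
    obtain ⟨x', w', hp2, -, rfl⟩ := List.map_eq_append_iff.1 hxw
    have hn3 := noBadSegment_sound hK he hpos hng (fun i hi => (hpmem i).1 hi) hseg
      (w := w') ⟨x', y', by rw [hp1, hp2]⟩ hS hSw hS0 (by simpa using hwlen)
    -- If `ext` holds, then `n > 3 * K` rules out the exempt length. Otherwise `w` is as long as the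
    -- full sequence and is not proper.
    cases hx : ext with
    | true =>
      rw [hx, Bool.not_true, Bool.false_or, Bool.and_eq_true, Bool.and_eq_true] at hgap
      have hKn' : 3 * K + 1 ≤ n := Nat.le_of_ble_eq_true hgap.1.1
      omega
    | false =>
      refine hwne (hw.eq_of_length ?_)
      rw [hwlen, hperm.length_eq, hRnil hx, List.append_nil, List.length_map, ← hn3, hp_def,
        length_digits]

theorem certifies_sound (hK3 : K ≤ 3) (hK : T.AtMostDisjointBlocks K) (hT : ¬ T.Sequenceable)
    {ext : Bool} (hext : ext = false → n = Fintype.card V)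
    (ss : List Step) : ∀ {prev : List (List ℕ)}, (∀ L ∈ prev, Refuted T n L) →
    certifies n K ext prev ss = true → ∃ L, Refuted T n L ∧ ∀ t ∈ L, t ∈ baseTriples K := by
  induction ss with
  | nil =>
    intro prev hprev h
    cases prev with
    | nil => simp [certifies] at h
    | cons L prev =>
      rw [certifies, List.all_eq_true] at h
      exact ⟨L, hprev L (by simp), fun t ht => (mem_iff _ _).1 (h t ht)⟩
  | cons s ss ih =>
    intro prev hprev h
    rw [certifies, Bool.and_eq_true] at h
    refine ih (fun L hL => ?_) h.2
    rcases List.mem_cons.1 hL with rfl | hL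
    · exact stepValid_sound hK3 hK hT hext hprev h.1
    · exact hprev L hL

/-- The points of the blocks in `S` come first, block by block, followed by all other points. -/
theorem exists_labelling {S : Finset (Finset V)} (hS : T.IsDisjointBlocks S) (hS0 : S.card ≠ 0) :
    ∃ e : ℕ → V, Set.InjOn e (Set.Iio (Fintype.card V)) ∧ ∀ i < S.card,
      ({e (3 * i), e (3 * i + 1), e (3 * i + 2)} : Finset V) ∈ T.blocks := by
  obtain ⟨B, hB⟩ := Finset.card_ne_zero.1 hS0
  obtain ⟨d, -⟩ : B.Nonempty := by
    rw [← Finset.card_pos, T.card_block B (hS.1 B hB)]; norm_num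
  obtain ⟨l, hnd, hlen, -, hl⟩ := exists_list_of_disjoint_triples d S.toList
    (fun B hB => T.card_block B (hS.1 B (by simpa using hB)))
    (S.nodup_toList.pairwise_of_forall_ne fun B hB C hC hBC =>
      hS.2 B (by simpa using hB) C (by simpa using hC) hBC)
  rw [Finset.length_toList] at hl hlen
  set r := (Finset.univ \ l.toFinset).toList with hr
  have hnd' : (l ++ r).Nodup := by
    rw [List.nodup_append]
    refine ⟨hnd, Finset.nodup_toList _, ?_⟩
    rintro x hx y hy rfl
    simp [hr, hx] at hy
  have hlen' : (l ++ r).length = Fintype.card V := by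
    rw [← List.toFinset_card_of_nodup hnd', ← Finset.card_univ]
    congr 1
    ext x
    by_cases hx : x ∈ l <;> simp [hr, hx]
  refine ⟨fun i => (l ++ r).getD i d, fun i hi j hj hij => ?_, fun i hi => ?_⟩
  · rw [Set.mem_Iio, ← hlen'] at hi hj
    simp only [List.getD_eq_getElem _ _ hi, List.getD_eq_getElem _ _ hj] at hij
    exact (hnd'.getElem_inj_iff).1 hij
  · have := hl i hi
    simp only
    rw [List.getD_append _ _ _ _ (by omega), List.getD_append _ _ _ _ (by omega),
      List.getD_append _ _ _ _ (by omega)]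
    exact hS.1 _ (by simpa using this)

/-- The blocks of `S` are a copy of the base triples, so the last configuration of a valid
certificate does occur. -/
theorem sequenceable_of_certifies (hK3 : K ≤ 3) (hK : T.AtMostDisjointBlocks K)
    {S : Finset (Finset V)} (hS : T.IsDisjointBlocks S) (hSK : S.card = K) (hK0 : K ≠ 0)
    {ext : Bool} (hn : n ≤ Fintype.card V) (hext : ext = false → n = Fintype.card V)
    {ss : List Step} (h : certifies n K ext [] ss = true) : T.Sequenceable := by
  by_contra hT
  obtain ⟨L, hL, hLK⟩ := certifies_sound hK3 hK hT hext ss (by simp) h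
  obtain ⟨e, he, hblocks⟩ := exists_labelling hS (by omega)
  refine hL e (he.mono (Set.Iio_subset_Iio hn)) fun t ht => ?_
  obtain ⟨i, hi, hit⟩ := exists_of_mem_baseTriples (V := V) hK3 (hLK t ht)
  rw [hit]
  exact hblocks i (by omega)

theorem sequenceable_of_atMost_zero (hK : T.AtMostDisjointBlocks 0) : T.Sequenceable := by
  refine ⟨Finset.univ.toList, Finset.nodup_toList _, by simp, ?_⟩
  rintro s ⟨-, hs, -⟩ ⟨S, hS, hSs⟩
  have : S = ∅ := Finset.card_eq_zero.1 (Nat.le_zero.1 (hK S hS))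
  rw [this, Finset.biUnion_empty, eq_comm, List.toFinset_eq_empty_iff] at hSs
  exact hs hSs

end Soundness

/-! ### Certificates

`certificate_K_n` is for systems with `n` points (`certificate_1_6`, `certificate_2_9` and
`certificate_3_14`: with at least `n` points) with at most `K` pairwise disjoint blocks. -/

def certificate_1_3 : List Step :=
  [
   ⟨[], 0x201, 0, []⟩]

theorem certifies_1_3 : certifies 3 1 false [] certificate_1_3 = true := by
  decide +kernel

def certificate_1_4 : List Step :=
  [
   ⟨[0x012], 0x2301, 0, []⟩]

theorem certifies_1_4 : certifies 4 1 false [] certificate_1_4 = true := by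
  decide +kernel

def certificate_1_5 : List Step :=
  [
   ⟨[0x012], 0x40231, 0, []⟩]

theorem certifies_1_5 : certifies 5 1 false [] certificate_1_5 = true := by
  decide +kernel

/-- The second sequence reads 3, 4, 2, 0, 5, 1. Only its segment 3, 4, 2 can be a block next to {0,
1, 2}, and then two blocks share one point, as excluded by the first step. New points go in front of
3, 4, away from the base triple. -/
def certificate_1_6 : List Step :=
  [
   ⟨[0x012, 0x045], 0x032145, 0, []⟩,
   ⟨[0x012], 0x150243, 0, [(0, 0x435102)]⟩]

theorem certifies_1_6 : certifies 6 1 true [] certificate_1_6 = true := by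
  decide +kernel

/-! ### Certificates for a maximum of two disjoint blocks -/

def certificate_2_6 : List Step :=
  [
   ⟨[0x012, 0x345], 0x425301, 0, []⟩]

theorem certifies_2_6 : certifies 6 2 false [] certificate_2_6 = true := by
  decide +kernel

def certificate_2_7 : List Step :=
  [
   ⟨[0x012, 0x036, 0x345], 0x3620451, 0, []⟩,
   ⟨[0x012, 0x345], 0x3602451, 0, [(0, 0x6543210)]⟩]

theorem certifies_2_7 : certifies 7 2 false [] certificate_2_7 = true := by
  decide +kernel

def certificate_2_8 : List Step :=
  [
   ⟨[0x012, 0x057, 0x345], 0x60725143, 0, []⟩,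
   ⟨[0x012, 0x345], 0x73046215, 0, [(0, 0x67453102), (0, 0x67453210), (0, 0x76354210),
    (0, 0x67354210), (0, 0x76453210)]⟩]

theorem certifies_2_8 : certifies 8 2 false [] certificate_2_8 = true := by
  decide +kernel

def certificate_2_9 : List Step :=
  [
   ⟨[0x012, 0x345, 0x046, 0x478], 0x781264305, 9, []⟩,
   ⟨[0x012, 0x345, 0x046, 0x278], 0x860275413, 9, []⟩,
   ⟨[0x012, 0x345, 0x046], 0x123056478, 0, [(1, 0x876543210), (0, 0x876201534)]⟩,
   ⟨[0x012, 0x345, 0x268], 0x103246578, 0, [(1, 0x107453268), (1, 0x107453286)]⟩,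
   ⟨[0x012, 0x345], 0x761804253, 9, [(1, 0x768543210), (0, 0x876543120), (0, 0x786543120),
    (0, 0x876210453), (1, 0x876543210), (0, 0x786543021), (0, 0x876543021), (0, 0x867543021)]⟩]

theorem certifies_2_9 : certifies 9 2 true [] certificate_2_9 = true := by
  decide +kernel

/-! ### Certificates for a maximum of three disjoint blocks -/

def certificate_3_9 : List Step :=
  [
   ⟨[0x012, 0x038, 0x345, 0x678], 0x573068214, 0, []⟩,
   ⟨[0x012, 0x345, 0x678], 0x043871526, 0, [(0, 0x687435102), (0, 0x786435201), (0, 0x786543201),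
    (0, 0x876543201), (0, 0x876435201), (0, 0x786543210), (0, 0x876543210)]⟩]

theorem certifies_3_9 : certifies 9 3 false [] certificate_3_9 = true := by
  decide +kernel

def certificate_3_10 : List Step :=
  [
   ⟨[0x012, 0x037, 0x345, 0x156, 0x678, 0x369, 0x289], 0x8943126075, 0, []⟩,
   ⟨[0x012, 0x345, 0x369, 0x678], 0x5143296087, 0, [(0, 0x9876453210), (0, 0x9876453120),
    (0, 0x9786453210), (0, 0x9786453120), (0, 0x9876453201), (0, 0x9786453201),
    (0, 0x9786453102), (0, 0x9876453102), (0, 0x9786453021), (0, 0x9786453012),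
    (0, 0x9876453021), (0, 0x9876453012), (0, 0x9543876201), (0, 0x9453876102),
    (0, 0x9453876201), (0, 0x9543876102), (0, 0x9543876210), (0, 0x9543876120),
    (0, 0x9453876012), (0, 0x9453876021), (0, 0x9453876210), (0, 0x9453876120),
    (0, 0x9543876012), (0, 0x9543876021)]⟩,
   ⟨[0x012, 0x345, 0x678], 0x7352049186, 0, [(0, 0x9768201543), (0, 0x9534201876),
    (0, 0x9534210876), (0, 0x9876201543), (0, 0x9876210543), (0, 0x9768210543),
    (0, 0x9768534210), (0, 0x9435102876), (0, 0x9534102876), (0, 0x9435201876),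
    (0, 0x9543210876), (0, 0x9543201876), (0, 0x9543102876), (0, 0x9435210876)]⟩]

theorem certifies_3_10 : certifies 10 3 false [] certificate_3_10 = true := by
  decide +kernel

def certificate_3_11 : List Step :=
  [
   ⟨[0x48a, 0x147, 0x678, 0x136, 0x56a, 0x257, 0x012, 0x389], 0x45706321a89, 0, []⟩,
   ⟨[0x012, 0x147, 0x345, 0x678, 0x389, 0x56a], 0x0a546371829, 0, [(0, 0x9a543876210),
    (0, 0x9a678345210), (0, 0xa9876543210), (0, 0xa9345678210), (0, 0xa9345678012),
    (0, 0xa9876543012)]⟩,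
   ⟨[0x012, 0x147, 0x345, 0x056, 0x678, 0x389, 0x69a], 0x3281407695a, 0, [(0, 0x321a5490867),
    (0, 0x320a4591867), (1, 0x4218537096a), (1, 0x0547128396a), (1, 0x2547108396a)]⟩,
   ⟨[0x012, 0x147, 0x345, 0x056, 0x678, 0x389], 0x47a68293501, 0, [(0, 0xa2056741938),
    (1, 0x01786534a92), (0, 0xa2174560983), (1, 0x2a389650714), (1, 0x2a398560714),
    (1, 0x2a065938714), (1, 0x2a893650714), (1, 0xa2560938714), (1, 0x2a983650714),
    (0, 0xa9876543210), (1, 0x2a839605471), (1, 0x2a389560471), (0, 0xa2147650938),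
    (1, 0x2a893605471), (1, 0xa2893605471), (1, 0x2a893650471), (1, 0x9a867534120),
    (1, 0xa9678534120), (1, 0xa9867543120), (1, 0x9a687543120), (1, 0xa9876453120),
    (1, 0x9a786453120)]⟩,
   ⟨[0x012, 0x147, 0x345, 0x678, 0x389], 0xa6827193045, 0, [(0, 0xa9453012687),
    (0, 0xa9543021687), (0, 0xa9543201687), (0, 0xa9453210687), (0, 0xa9687021543),
    (0, 0xa9786102543), (0, 0xa9687201543), (0, 0xa9786120543), (2, 0x9a867201534),
    (2, 0xa9678201534), (2, 0x9a876201534), (2, 0xa9678120534), (2, 0xa9768210534),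
    (2, 0xa9768120534), (2, 0x9a867210534), (2, 0x9a876120534)]⟩,
   ⟨[0x012, 0x147, 0x345, 0x678], 0x4208a536971, 0, [(0, 0xa9678543210), (0, 0x9a876345210),
    (0, 0x9a876210543), (0, 0xa9768435210), (0, 0xa9768453210), (0, 0x9a678543210),
    (0, 0x9a678345210), (0, 0xa9678345210), (0, 0x9a876543210), (0, 0x9a543012876),
    (0, 0x9a345210876), (0, 0x9a345012876), (0, 0x9a543210876), (0, 0x9a453120786),
    (0, 0x9a453102786), (3, 0x42185360a79), (0, 0x9a768435201), (0, 0xa9768435201),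
    (3, 0x42073561a89), (3, 0x42185370a69), (0, 0xa9876345210), (3, 0x42083561a79),
    (0, 0x9a786435201), (0, 0xa9786435201), (0, 0xa9345210876), (3, 0x42183560a79),
    (0, 0x9a768453201), (0, 0xa9768453201), (3, 0x42075361a89), (3, 0x42183570a69),
    (0, 0xa9876543210), (3, 0x42085361a79), (0, 0x9a786453201), (0, 0xa9786453201),
    (0, 0xa9543210876), (0, 0xa9678210543), (0, 0x9a678210543), (0, 0xa9876210543),
    (3, 0x52174360a89), (3, 0x86345210a79), (0, 0xa9876012543), (0, 0x9a876012543),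
    (3, 0x30174562a89), (3, 0x30285471a69), (3, 0x68345210a79), (3, 0x52083471a69),
    (0, 0xa9678012543), (0, 0x9a678012543), (3, 0x32174560a89), (3, 0x86543210a79),
    (3, 0x50174362a89), (3, 0x50283471a69), (3, 0x68543210a79), (3, 0x32085471a69),
    (3, 0x82147630a59), (3, 0x53678210a49), (0, 0xa9543012876), (3, 0x62147830a59),
    (3, 0x53876210a49), (3, 0x60147832a59), (3, 0x60258741a39), (3, 0x80147632a59),
    (3, 0x80256741a39), (3, 0x35678210a49), (0, 0xa9345012876), (3, 0x82056741a39),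
    (3, 0x35876210a49), (3, 0x62058741a39)]⟩,
   ⟨[0x012, 0x189, 0x678, 0x345], 0x7426853910a, 0, [(1, 0xa9867021543), (1, 0xa9876021543),
    (1, 0x24390a15786), (1, 0x24590a13786), (0, 0xa9786534120), (0, 0xa9786453120),
    (1, 0x74396a85210), (1, 0x74596a83210), (1, 0xa9867201534), (0, 0xa9786534201),
    (0, 0xa9867453210), (1, 0xa9867021453), (1, 0xa9867201453), (0, 0xa9786453201),
    (0, 0xa9867534210), (1, 0xa9867021534), (0, 0xa9876534210), (0, 0xa9876453210)]⟩,
   ⟨[0x012, 0x345, 0x678], 0x2347091685a, 0, [(0, 0x9a876210453), (0, 0xa9687543210),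
    (0, 0xa9786543201), (1, 0xa9876543201), (1, 0xa9867453210), (1, 0xa9786453210),
    (0, 0x9a687543210), (0, 0xa9876543210), (0, 0x9a876543210), (1, 0xa9867543201),
    (0, 0xa9687543201), (1, 0xa9876534201), (0, 0xa9354876201), (0, 0xa9453876201),
    (1, 0xa9786543201), (0, 0x9a453876201), (1, 0xa9867453201), (1, 0xa9876453201),
    (1, 0xa9786453201), (0, 0xa9543876201), (0, 0x9a543876201), (0, 0x9a687543201),
    (0, 0x9a786543201), (0, 0xa9876543201), (0, 0x9a876543201), (1, 0xa9867534201),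
    (1, 0xa9786534201)]⟩]

theorem certifies_3_11 : certifies 11 3 false [] certificate_3_11 = true := by
  decide +kernel

def certificate_3_12 : List Step :=
  [
   ⟨[0x678, 0x58a, 0x7ab, 0x46b, 0x345, 0x03a, 0x047, 0x579, 0x012], 0x80a63b745129, 0, []⟩,
   ⟨[0x012, 0x03a, 0x345, 0x047, 0x7ab, 0x58a, 0x678, 0x369], 0x9b3465a70821, 0, [
    (0, 0xba9876543210)]⟩,
   ⟨[0x237, 0x345, 0x047, 0x012, 0x14a, 0x58a, 0x678, 0x136, 0x7ab, 0x06b],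
    0x9a405b763812, 0, []⟩,
   ⟨[0x012, 0x03a, 0x136, 0x345, 0x047, 0x678, 0x58a, 0x7ab], 0xb127063a4859, 0, [
    (0, 0xba9876543210)]⟩,
   ⟨[0x012, 0x03a, 0x345, 0x047, 0x7ab, 0x056, 0x678, 0x48a, 0x379], 0xb06182a73495, 0, [
    (0, 0x56b201a48937), (0, 0x56b102a48937)]⟩,
   ⟨[0x012, 0x03a, 0x137, 0x047, 0x345, 0x7ab, 0x056, 0x678, 0x48a], 0xb128a3574609, 0, [
    (1, 0xba9876435201), (1, 0x60925b1378a4)]⟩,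
   ⟨[0x345, 0x03a, 0x28a, 0x012, 0x157, 0x678, 0x06b, 0x7ab], 0x910b57a42836, 0, [
    (2, 0x17935428a06b), (2, 0x1793542a80b6), (2, 0x1794532a80b6), (2, 0x17945328a60b),
    (4, 0x9140a32b5867), (2, 0x903678b524a1)]⟩,
   ⟨[0x012, 0x03a, 0x345, 0x047, 0x7ab, 0x678], 0xb1260a758349, 0, [(5, 0xba9876543210),
    (5, 0xba9678543210), (2, 0xba9876543210), (2, 0xba9678543210), (3, 0xba9876543120),
    (3, 0xba9678543120), (1, 0xba9876543120), (1, 0xba9678543120), (3, 0xba9876210453),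
    (3, 0xba9876120453), (3, 0xba9678210453), (3, 0xba9678120453), (0, 0xba9876543210),
    (0, 0xba9876543120), (0, 0xba9678543210), (0, 0xba9678543120)]⟩,
   ⟨[0x012, 0x03a, 0x345, 0x047, 0x259, 0x678], 0xb0a473569821, 0, [(0, 0x72ba30849615),
    (0, 0x79ba30842615), (4, 0xa0b236157984), (4, 0xa0b238157964), (0, 0x89ba30642715),
    (0, 0x69ba30842715), (0, 0x72ba30649815), (0, 0x79ba30642815), (0, 0x63b120894a75),
    (0, 0x73b120694a85), (0, 0x73b120894a65), (0, 0x83b120694a75), (0, 0x64b120793a85),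
    (0, 0x64b120893a75), (0, 0x84b120693a75), (0, 0x84b120793a65), (0, 0x74b2018a5963),
    (0, 0x74b2016a5983), (0, 0x65b2018a4973), (0, 0x85b2016a4973), (0, 0xa38201b75964),
    (0, 0x748201ba5963), (0, 0x7482016a5b93), (0, 0x935876b4a210), (0, 0xb3587694a210),
    (0, 0xb582016a4973), (0, 0xba9876543210), (0, 0x9ab876543210)]⟩,
   ⟨[0x012, 0x03a, 0x345, 0x047, 0x678, 0x8ab], 0x910b284a7356, 0, [(1, 0x679b8a120534),
    (1, 0xba9786120543), (2, 0xba9687210453), (1, 0xba9786453210), (1, 0x679b8a210534),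
    (1, 0xa16543b72980), (1, 0xb16543a72980), (1, 0xb26543a71980), (1, 0xa26543b71980)]⟩,
   ⟨[0x012, 0x03a, 0x345, 0x047, 0x678, 0x19b], 0xa539461b0287, 0, [(2, 0x20ab19867534),
    (0, 0x20a19b867534), (0, 0x20a1b9867534), (0, 0x9ab678543210), (2, 0x20ab19687534),
    (0, 0x20a1b9687534), (0, 0x20a19b687534), (1, 0x591b428763a0), (1, 0x5b19428763a0),
    (1, 0x591b426783a0), (1, 0x5b19426783a0), (3, 0x20a91b687534), (3, 0x20ab19687534),
    (1, 0x539876b4a120), (1, 0x23b87614a950), (1, 0x53b87694a120), (1, 0x23987614ab50)]⟩,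
   ⟨[0x012, 0x03a, 0x345, 0x047, 0x678, 0x49b], 0x3097124568ba, 0, [(1, 0xba9876543210),
    (3, 0xb9a543201867), (3, 0x3a5201876b94), (3, 0x3a5201678b94), (3, 0x125a03876b94),
    (3, 0x125a03678b94), (3, 0x215a03876b94), (3, 0x215a03678b94), (3, 0xa35201b49867),
    (2, 0x9ab876543210), (2, 0x9ab876543120), (1, 0x152678a03b94), (1, 0x152876a03b94),
    (1, 0x251876a03b94), (1, 0x251678a03b94), (0, 0xba9867210543), (2, 0xba9876543120)]⟩,
   ⟨[0x012, 0x03a, 0x345, 0x047, 0x678], 0x81250493ab76, 0, [(4, 0xba9876543210),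
    (4, 0x9ab876543210), (2, 0xba9678543210), (2, 0x9ab678543210), (4, 0x935876b4a210),
    (4, 0xb3587694a210), (0, 0xba9876543210), (4, 0xa38201b75964), (4, 0xa38201975b64),
    (4, 0x748201ba5963), (4, 0x7482019a5b63), (4, 0x7482016a5b93), (4, 0x9582016a4b73),
    (4, 0xb582016a4973), (4, 0xb51876a03924), (4, 0x951876a03b24), (1, 0x816ba5932470),
    (1, 0x8169a5b32470), (1, 0x816b395a2470), (4, 0x539b4a102867), (4, 0xb3187624a950),
    (4, 0x53ba49102867), (4, 0x93187624ab50), (4, 0x2a1876543b90), (3, 0x9ab876543210),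
    (3, 0xba9876543210), (3, 0xba9876543120), (3, 0x9ab876543120), (2, 0x9ab876543210),
    (2, 0x52b876941a30), (2, 0x51b876942a30), (3, 0xba9876102354), (3, 0xba9876201354),
    (2, 0x31b876a42950), (2, 0x32b876a41950)]⟩,
   ⟨[0x012, 0x03a, 0x345, 0x69a, 0x678], 0xb123a9568407, 0, [(3, 0x9ab678543210),
    (3, 0x9ab687543210), (5, 0x9ab867543210), (5, 0x9ab867453210), (0, 0xb0486719352a),
    (0, 0xb0486729351a), (2, 0x8b753410296a), (2, 0x8b753420196a), (0, 0xb713a0598426),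
    (0, 0xb713a0498526), (5, 0x9ab867120543), (5, 0x9ab867210543), (0, 0xb8720143596a),
    (0, 0xb8720153496a), (0, 0xb872016a9543), (3, 0x9ab687210543), (5, 0x697ba8201543),
    (0, 0xb8753410296a), (0, 0x8b79a6201543), (5, 0x697ba8102543), (0, 0x8b79a6102543),
    (0, 0x8b72019a6543), (3, 0x9ab687120543), (0, 0xb8753420196a)]⟩,
   ⟨[0x012, 0x03a, 0x345, 0x489, 0x678], 0xb1274689035a, 0, [(1, 0xb9a120678534),
    (1, 0xba9786453210), (1, 0xb9a210768534), (1, 0xb9a210678534), (1, 0xb9a120768534),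
    (1, 0xba9867543210), (1, 0xba9876543210), (1, 0xba9867453210), (1, 0xba9876453210)]⟩,
   ⟨[0x012, 0x03a, 0x345, 0x678], 0x8123a975b640, 0, [(2, 0xba9867543210), (0, 0x9ab687543210),
    (0, 0x9ab687453210), (0, 0x9ab786453210), (0, 0xba9786453210), (1, 0xba9867543210),
    (2, 0xba9867453210), (0, 0x9ab786543210), (0, 0xba9687453210), (0, 0x4387b956a210),
    (0, 0x4386b957a210), (4, 0x846201ba5973), (4, 0x8462019a5b73), (2, 0x8462017a5b93),
    (2, 0xba9876120543), (0, 0xb9a786453102), (0, 0xba9786435102), (2, 0xba9876210543),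
    (0, 0xb9a786021543), (0, 0xb9a786012543), (2, 0xba9786210543), (0, 0xb9a876021543),
    (0, 0xb9a876012543), (2, 0xba9786120543), (2, 0xba9876543210), (7, 0x9482017a5b63),
    (7, 0x9482016a5b73), (7, 0xb482017a5963), (7, 0xb482016a5973), (2, 0xba9876453210),
    (7, 0x9582017a4b63), (7, 0x9582016a4b73), (7, 0xb582017a4963), (7, 0xb582016a4973),
    (1, 0x9ab867543210), (1, 0x9ab876543210), (1, 0xba9876543210), (2, 0xba9867120543),
    (0, 0xba9687543210), (0, 0xba9786543210), (5, 0x108247b5a963), (5, 0x10824795ab63),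
    (5, 0x10824765ab93), (6, 0x10894275a6b3), (6, 0x10894265a7b3), (6, 0x108b4275a693),
    (6, 0x108b4265a793), (5, 0x108256b4a973), (5, 0x10825694ab73), (5, 0x10825674ab93),
    (5, 0x108257b4a963), (5, 0x10825794ab63), (5, 0x10825764ab93), (6, 0x10895274a6b3),
    (6, 0x10895264a7b3), (6, 0x108b5274a693), (6, 0x108b5264a793), (0, 0x1087b926a543),
    (0, 0x1086b927a543), (2, 0xba9867210543), (0, 0x9ab687120543), (0, 0x9ab786120543),
    (0, 0xba9687120543), (0, 0xba9786120543), (1, 0xa54b93876201), (1, 0xb10a92876435),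
    (1, 0x910ba2876435), (1, 0xa54b93867201), (1, 0xb10a92867435), (1, 0x910ba2867435),
    (0, 0xa9b786435201), (0, 0xa9b687435201), (0, 0xab9786435201), (0, 0xab9687435201),
    (0, 0xba9687210543), (1, 0xa54b93867102), (0, 0x9ab354876201), (0, 0xba9354876201),
    (0, 0x9ab687210543), (0, 0xba9786210543), (1, 0xa54b93876102), (0, 0x9ab354867201),
    (0, 0xba9354867201), (0, 0x9ab786210543), (1, 0xb20a91876435), (1, 0xb20a91867435),
    (1, 0x920ba1876435), (1, 0x920ba1867435), (1, 0x9ab768543210), (0, 0x9ab876120543),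
    (1, 0xba9768543210), (0, 0xba9876453210), (0, 0xba9876120543), (1, 0xa54b93768201),
    (1, 0xb10a92768435), (1, 0x910ba2768435), (0, 0xa9b876435201), (0, 0xab9876435201),
    (1, 0xa54b93768102), (0, 0x9ab354687201), (0, 0xba9354687201), (0, 0xba9876210543),
    (0, 0x9ab354678201), (0, 0xba9354678201), (0, 0x9ab876210543), (1, 0xb20a91768435),
    (1, 0x920ba1768435)]⟩,
   ⟨[0x012, 0x345, 0x678], 0x38b179504a62, 0, [(0, 0xba9543876102), (0, 0xba9210876534),
    (0, 0xba9876534210), (0, 0xb9a876435210), (0, 0xb9a210867435), (0, 0xb9a543867201),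
    (0, 0xab9543867201), (0, 0xab9543768201), (0, 0xab9210768543), (0, 0xba9876435102),
    (0, 0xba9876534102), (0, 0xba9876435210), (2, 0xb43a95876210), (0, 0xb9a876534210),
    (2, 0xb53a94876210), (2, 0xb43a95867210), (2, 0xb53a94867210), (0, 0xb9a876435201),
    (0, 0xb9a876534201), (2, 0xa02b91867435), (0, 0xb9a543867210), (2, 0xa12b90867435),
    (2, 0xa76b98435201), (2, 0xa86b97435201), (0, 0xb9a543768201), (2, 0xa76b98543201),
    (2, 0xa86b97543201), (0, 0xb9a210876534), (0, 0xb9a210867534), (0, 0xba9210867534),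
    (2, 0xb01a92876534), (0, 0xba9876435201), (0, 0xba9543867201), (2, 0xb02a91876534),
    (2, 0xb01a92867534), (0, 0xba9543876201), (2, 0xb02a91867534), (2, 0xb10a92867534),
    (0, 0xba9876534201), (2, 0xb20a91867534), (2, 0xb10a92876534), (2, 0xb20a91876534),
    (0, 0xba9543876210), (0, 0xba9543867210), (2, 0xb12a90876534), (2, 0xb12a90867534),
    (2, 0xb21a90867534), (2, 0xb21a90876534), (0, 0xab9876435201), (0, 0xba9210867435),
    (0, 0xb9a543876201), (0, 0xab9543876201), (0, 0xba9210876435), (0, 0xb9a210876435),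
    (0, 0xab9876534210), (0, 0xab9876534201), (0, 0xab9210867534), (0, 0xab9210876534),
    (0, 0xab9876435210), (0, 0xb9a543876210), (0, 0xab9543876210), (0, 0xab9543867210),
    (0, 0xba9543768201), (0, 0xba9210768435), (0, 0xb9a210768435), (0, 0xab9210867435),
    (0, 0xab9210768534), (0, 0xb9a210768534), (0, 0xb9a543768210), (0, 0xba9543768210),
    (0, 0xab9543768210), (2, 0xa34b95867210), (2, 0xa35b94867210), (2, 0xa34b95768210),
    (2, 0xa35b94768210), (0, 0xb9a876543210), (2, 0xa43b95867210), (0, 0xb9a876543201),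
    (2, 0xa45b93867210), (2, 0xa43b95768210), (2, 0xa45b93768210), (2, 0xa53b94867210),
    (2, 0xa54b93867210), (2, 0xa53b94768210), (2, 0xa54b93768210)]⟩]

theorem certifies_3_12 : certifies 12 3 false [] certificate_3_12 = true := by
  decide +kernel

def certificate_3_13 : List Step :=
  [
   ⟨[0x012, 0x09c, 0x1bc, 0x0ab, 0x23a, 0x27c, 0x345, 0x678], 0xa6b87105c4329, 0, []⟩,
   ⟨[0x012, 0x09c, 0x1bc, 0x39b, 0x23a, 0x8ac, 0x345, 0x678], 0x01c4953a8b762, 0, []⟩,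
   ⟨[0x012, 0x09c, 0x1bc, 0x179, 0x28c, 0x678, 0x046, 0x345, 0x23a], 0xa7961b408c523, 0, [
    (0, 0x0c62453ba8791)]⟩,
   ⟨[0x012, 0x09c, 0x1bc, 0x23a, 0x345, 0x678], 0x4568071c92ab3, 0, [(2, 0xc9ab876543201),
    (1, 0xcba9786543210), (2, 0xcba9876543210), (0, 0xcba9876453210), (0, 0xcba9786453210),
    (0, 0xcba9867453210), (0, 0xcba9687453210), (0, 0xcba9768453210), (0, 0xcba9678453210)]⟩,
   ⟨[0x012, 0x09c, 0x23a, 0x345, 0x17b, 0x678], 0x01b254a63789c, 0, [(0, 0x3285c90b176a4),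
    (0, 0x341ac90867b52), (0, 0x358ac90b17642), (0, 0x351ac90867b42), (0, 0x348ac90b17652),
    (0, 0x3264c90b178a5), (0, 0x3265c90b178a4), (0, 0x3284c90b176a5), (0, 0x356ac90b17842),
    (0, 0x346ac90b17852), (0, 0x5b14876c902a3), (0, 0x4b15876c902a3), (0, 0x32b5c908671a4),
    (0, 0x32b4c908671a5), (0, 0x6a28543c901b7), (0, 0x784bc90a23561), (0, 0x785bc90a23461)]⟩,
   ⟨[0x012, 0x09c, 0x23a, 0x345, 0x678], 0x3754c9b01a268, 0, [(0, 0x51b4c09876a23),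
    (0, 0xb145a2386790c), (0, 0xb145a23867c09), (0, 0xb154a23867c09), (0, 0xb154a2386790c),
    (1, 0x9bac876543210), (1, 0xcba9876543210), (0, 0x2ab1543876c90), (0, 0x2ba1543876c90),
    (0, 0x2ba1867534c90), (0, 0x2ab1867534c90), (0, 0xca9b543876102), (0, 0xbac9543876102),
    (0, 0xabc9543876201), (0, 0xcb9a543876201), (0, 0xca9b867534102), (0, 0xbac9867534102),
    (0, 0xabc9867534201), (0, 0xcb9a867534201), (1, 0x41b5c908762a3), (1, 0x451bc90876a32),
    (0, 0xb9ca543876210), (0, 0xbc9a543876210), (0, 0xb9ca867534210), (0, 0xbc9a867534210),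
    (1, 0xa349cb5867021), (1, 0xa34cb95867021), (0, 0x54b13a2867c09), (0, 0x54b13a286790c),
    (1, 0xa394cb5867120), (1, 0xa3c4b95867120), (0, 0xb934876c5a210), (0, 0xbc3487695a210),
    (0, 0xb1543a2867c90), (0, 0xb51487632ac90), (1, 0xa359cb4867021), (1, 0xa35cb94867021),
    (0, 0x45b13a2867c09), (0, 0x45b13a286790c), (1, 0xa395cb4867120), (1, 0xa3c5b94867120),
    (0, 0xb935876c4a210), (0, 0xbc3587694a210), (0, 0xb1453a2867c90), (0, 0xb41587632ac90),
    (0, 0x9b34876c5a201), (0, 0xcb3487695a201), (0, 0x9b35876c4a201), (0, 0xcb3587694a201),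
    (1, 0x5b14876c902a3), (1, 0xa1b2c90867543), (1, 0x4b15876c902a3), (1, 0xa1b2c90867453),
    (0, 0x4b513a2867c09), (0, 0x4b513a286790c), (0, 0x5b413a2867c09), (0, 0x5b413a286790c),
    (0, 0x4b51a32867c09), (0, 0x4b51a3286790c), (0, 0x5b41a32867c09), (0, 0x5b41a3286790c),
    (1, 0x3a49cb5867021), (1, 0x3a4cb95867021), (0, 0x94a5876cb3201), (0, 0xc4a5876b93201),
    (0, 0xb154a32867c90), (0, 0xb514876a23c90), (1, 0x3a59cb4867021), (1, 0x3a5cb94867021),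
    (0, 0x95a4876cb3201), (0, 0xc5a4876b93201), (0, 0xb145a32867c90), (0, 0xb415876a23c90),
    (0, 0xcba9876543210)]⟩,
   ⟨[0x012, 0x09c, 0x345, 0x678], 0x853c49ab20671, 0, [(0, 0x2ba18765349c0),
    (0, 0xcab9543867210), (0, 0xcba9543867210), (0, 0xcab9543876210), (0, 0xcba9543876210),
    (0, 0xbca9543876012), (0, 0xacb9543876012), (0, 0xbc9a543876210), (0, 0xbca9876534012),
    (0, 0xacb9876534012), (0, 0xbc9a876534210), (0, 0x2ab1876534c90), (0, 0x2ba1876534c90),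
    (0, 0x2ab18765349c0), (1, 0x58c3b7a210964), (0, 0x2ab15438679c0), (0, 0x2ba15438679c0),
    (1, 0x58c3b6a210974), (0, 0x2ab15438769c0), (0, 0x2ba15438769c0), (0, 0xcba9543867120),
    (0, 0xcab9543867120), (0, 0xcba9543876120), (0, 0xcab9543876120), (0, 0xcab9876534120),
    (0, 0xcab9876534210), (0, 0xbca9543876021), (0, 0xcba9876534120), (0, 0xcba9876534210),
    (0, 0xacb9543876021), (0, 0xbca9543867012), (0, 0xbca9543867021), (0, 0xacb9543867012),
    (0, 0xacb9543867021), (0, 0xbc9a543867210), (0, 0xbc9a543876120), (0, 0xbc9a543867120),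
    (0, 0x2ab1543867c90), (0, 0x2ba1543867c90), (0, 0x2ab1543876c90), (0, 0x2ba1543876c90),
    (0, 0xc9ab543876012), (0, 0xc9ba543876012), (0, 0xc9ab543867012), (0, 0xc9ba543867012),
    (1, 0x5183c09ba7624), (1, 0x5183c09ba6724), (0, 0xb9ca543876210), (0, 0xb9ca543867210),
    (0, 0xbca9876543012), (0, 0xc9ab876543012), (0, 0xacb9876543012), (0, 0xc9ba876543012),
    (0, 0x2ab1876543c90), (0, 0x2ba1876543c90), (0, 0x2ab18765439c0), (0, 0x2ba18765439c0),
    (0, 0xc9ab876534012), (0, 0xc9ba876534012), (1, 0x8157c09ba4326), (0, 0xcba9876543210),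
    (0, 0xcab9876543210), (1, 0x8157c09ba3426), (0, 0xbc9a876543210), (0, 0xb9ca876543210),
    (0, 0xb9ca876534210), (0, 0x2ab1876435c90), (0, 0x2ab18764359c0), (0, 0x2ba1876435c90),
    (0, 0x2ba18764359c0), (2, 0x2341ba5768c90), (2, 0x2351ba4768c90), (2, 0x2341ba57689c0),
    (2, 0x2351ba47689c0), (2, 0x2431ba5768c90), (2, 0x2451ba3768c90), (2, 0x2431ba57689c0),
    (2, 0x2451ba37689c0), (2, 0x2531ba4768c90), (2, 0x2541ba3768c90), (2, 0x2531ba47689c0),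
    (2, 0x2541ba37689c0), (0, 0x2ab1543768c90), (0, 0x2ba1543768c90), (0, 0x2ab15437689c0),
    (0, 0x2ba15437689c0)]⟩,
   ⟨[0x012, 0x345, 0x678], 0x52091ba8c7643, 0, [(0, 0xcb9a543210768), (0, 0xbc9a543210768),
    (0, 0xbc9a876543201), (0, 0xbca9876543201), (0, 0xcb9a876210534), (0, 0xca9b543210768),
    (0, 0xca9b543210867), (0, 0xcb9a543210867), (0, 0xbc9a543210867), (0, 0xcb9a876543201),
    (0, 0xca9b876543201), (0, 0xacb9876543201), (0, 0xacb9876543210), (0, 0xbca9876543210),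
    (0, 0xbc9a876543210), (0, 0xbca9876210435), (0, 0xca9b543210876), (0, 0xcb9a543210876),
    (0, 0xbc9a543210876), (0, 0xca9b876210534), (0, 0xbc9a876210534), (0, 0xca9b876210543),
    (0, 0xcb9a876210543), (0, 0xbc9a876210543), (0, 0xa956c84b73201), (0, 0xa956b84c73201),
    (0, 0xa956c74b83201), (0, 0xa956b74c83201), (0, 0xb956c84a73201), (0, 0xb956a84c73201),
    (0, 0xb956c74a83201), (0, 0xb956a74c83201), (0, 0xc956b84a73201), (0, 0xc956a84b73201),
    (0, 0xc956b74a83201), (0, 0xc956a74b83201), (0, 0xa957c84b63201), (0, 0xa957b84c63201),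
    (0, 0xa957c64b83201), (0, 0xa957b64c83201), (0, 0xb957c84a63201), (0, 0xb957a84c63201),
    (0, 0xb957c64a83201), (0, 0xb957a64c83201), (0, 0xc957b84a63201), (0, 0xc957a84b63201),
    (0, 0xc957b64a83201), (0, 0xc957a64b83201), (0, 0xa958c74b63201), (0, 0xa958b74c63201),
    (0, 0xa958c64b73201), (0, 0xa958b64c73201), (0, 0xb958c74a63201), (0, 0xb958a74c63201),
    (0, 0xb958c64a73201), (0, 0xb958a64c73201), (0, 0xc958b74a63201), (0, 0xc958a74b63201),
    (0, 0xc958b64a73201), (0, 0xc958a64b73201), (0, 0xcba9543210768), (0, 0xbca9543210768),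
    (0, 0xcba9543210867), (0, 0xbca9543210867), (0, 0xacb9543210768), (0, 0xacb9543210867),
    (0, 0xcba9543210876), (0, 0xbca9543210876), (0, 0xacb9543210876), (0, 0xca9b876543102),
    (0, 0xcb9a876543102), (0, 0xbc9a876543102), (0, 0xcba9876543102), (0, 0xbca9876543102),
    (0, 0xcba9876543201), (0, 0xacb9876543102), (0, 0xcba9876543210), (0, 0xcb9a876543210),
    (0, 0xca9b876543210)]⟩]

theorem certifies_3_13 : certifies 13 3 false [] certificate_3_13 = true := by
  decide +kernel

/-- A gap at an end of the sequence works because the nearest 2, 5 and 8 labels meet at most 0, 1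
and 2 base triples; the labels from 9 on serve as the buffer. -/
def certificate_3_14 : List Step :=
  [
   ⟨[0x012, 0x345, 0x678, 0x8ab, 0x36c, 0x19d, 0x037, 0x259], 0x8657429301cdba, 0, []⟩,
   ⟨[0x012, 0x345, 0x678, 0x8ab, 0x36c, 0x19d, 0x14c, 0x23d], 0xba539d24107c68, 14, []⟩,
   ⟨[0x012, 0x345, 0x678, 0x8ab, 0x36c, 0x19d, 0x037, 0x16a, 0x28c], 0x017386c2549dba, 0, [
    (1, 0xdcba9876453210), (1, 0x9cbad876453210), (1, 0xdcba9876543210), (1, 0x9cbad876543210)]⟩,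
   ⟨[0x012, 0x345, 0x678, 0x8ab, 0x36c, 0x19d, 0x49b], 0x84760253c1da9b, 0, []⟩,
   ⟨[0x012, 0x345, 0x678, 0x8ab, 0x36c, 0x19d], 0x152087a6bc34d9, 0, [(0, 0x9cbad876543210),
    (0, 0xdcab9876543210), (0, 0xdcba9876543210), (0, 0x9cabd876543210), (0, 0x74b2a6c3085d19),
    (0, 0x74a2b6c3085d19), (0, 0x7c82b5430a6d19), (0, 0x7c82a5430b6d19)]⟩,
   ⟨[0x012, 0x345, 0x678, 0x8ab, 0x36c, 0x258], 0x8265734d9cab10, 4, [(0, 0xdcba9876543210),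
    (0, 0xdcba9876543201), (0, 0x97d546c3102b8a), (0, 0xd79546c3102b8a), (0, 0x79d546c3ba8120),
    (0, 0x7d9546c3ba8120), (0, 0xdcba9876543120)]⟩,
   ⟨[0x012, 0x345, 0x678, 0x8ab, 0x36c], 0xac679d45208b13, 14, [(0, 0xd75493c6ba8120),
    (0, 0xdcba9876453021), (0, 0xdcba9876543210), (0, 0xdcba9876543021), (0, 0xdcba9876453210),
    (0, 0x9dc673450128ba), (0, 0x9dc673540218ba), (0, 0x9dc673540128ba), (0, 0x9dc673450218ba),
    (0, 0xd75493c6ba8021), (0, 0xdcba9876453120), (0, 0xdcba9876543120), (0, 0x9dc673451028ba),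
    (0, 0x9dc673452018ba), (0, 0x9dc673541208ba), (0, 0x9dc673542108ba), (0, 0x9dc673541028ba),
    (0, 0x9dc673542018ba), (0, 0x9dc673451208ba), (0, 0x9dc673452108ba), (1, 0xd7c69345102b8a),
    (1, 0x9dc67345ba8120), (1, 0xd9c67345ba8120), (1, 0xd7c69354210b8a), (2, 0xd9475012c36b8a),
    (2, 0x9d475012c36b8a), (1, 0xd9745012ba8c63), (1, 0x9d745012ba8c63), (1, 0xd7c69354102b8a),
    (1, 0x9dc67354ba8120), (1, 0xd9c67354ba8120), (1, 0xd7c69345210b8a), (2, 0xd9574012c36b8a),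
    (2, 0x9d574012c36b8a), (1, 0xd9754012ba8c63), (1, 0x9d754012ba8c63), (2, 0xd9475210c36b8a),
    (2, 0xd9574210c36b8a), (2, 0x9d475210c36b8a), (2, 0x9d574210c36b8a), (1, 0x9dc67345ba8201),
    (1, 0x9dc67354ba8201), (1, 0xd9c67345ba8201), (1, 0xd9c67354ba8201), (1, 0xd9745210ba8c63),
    (1, 0xd9754210ba8c63), (1, 0x9d745210ba8c63), (1, 0x9d754210ba8c63), (1, 0xdcba9876543120),
    (1, 0xdcba9876543201), (1, 0xd6c97534102ba8), (1, 0x96dc7534102ba8), (1, 0x7d954c36b8a120),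
    (1, 0x79d54c36b8a120), (1, 0x97d5463cb8a120), (1, 0x9d754c36b8a120), (1, 0xdc967534102ba8),
    (1, 0x9cd67534102ba8), (1, 0xd795463cb8a120), (1, 0xd9754c36b8a120), (1, 0xd6c97435102ba8),
    (1, 0x96dc7435102ba8), (1, 0x7d945c36b8a120), (1, 0x79d45c36b8a120), (1, 0x97d4563cb8a120),
    (1, 0x9d745c36b8a120), (1, 0xdc967435102ba8), (1, 0x9cd67435102ba8), (1, 0xd794563cb8a120),
    (1, 0xd9745c36b8a120), (1, 0x97dc6534b8a120), (2, 0x9d7c6435b8a120), (2, 0x9d7c6534b8a120),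
    (1, 0x97dc6435b8a120), (1, 0xd7c96534b8a120), (2, 0xd97c6435b8a120), (2, 0xd97c6534b8a120),
    (1, 0xd7c96435b8a120), (1, 0x96dc7534b8a120), (2, 0x9c6d7435b8a120), (2, 0x9c6d7534b8a120),
    (1, 0x96dc7435b8a120), (2, 0xcd697435b8a120), (2, 0xc96d7435b8a120), (2, 0xc96d7534b8a120),
    (2, 0xcd697534b8a120), (2, 0xdc697435b8a120), (1, 0xd6c97534b8a120), (1, 0xd6c97435b8a120),
    (2, 0xdc697534b8a120), (1, 0xcdba9876534120), (1, 0xcdba9876435120), (1, 0xd9bac876534120),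
    (1, 0xd9bac876435120)]⟩,
   ⟨[0x012, 0x345, 0x678, 0x8ab, 0x59c], 0xca09126d47b835, 14, [(0, 0xdbc9a534867210),
    (2, 0xcdba9876102453), (0, 0xd976c8ba210543), (0, 0xdc7698ba210543), (0, 0xdbc9a543867210),
    (0, 0xd6c97534102ba8), (0, 0xd7c96534102ba8), (2, 0xcdba9867102453), (0, 0xd6c97534201ba8),
    (2, 0xbdc9a534201786), (0, 0xd9bac876201543), (2, 0xcdba9876201453), (0, 0xdcb87a69435210),
    (0, 0xd6c97543102ba8), (0, 0xd7c96543102ba8), (0, 0xdbc9a534876210), (0, 0xdbc9a543876210),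
    (2, 0xcd7698ab102453), (0, 0xd6c97543201ba8), (0, 0xd7c96543201ba8), (0, 0xdbc9a543201876),
    (2, 0xbdc9a543201786), (0, 0xd7c96534201ba8), (0, 0xdbc9a534201876), (0, 0xd9bac876102543),
    (0, 0xd9bac867102543), (0, 0xd9bac867534210), (0, 0xd9bac867201543), (0, 0xd9bac876534210),
    (2, 0xcdba9867201453), (0, 0xd976c8ab201543), (2, 0xbd43a5c9201786), (2, 0xcd7698ab201453),
    (0, 0xd6c97534210ba8), (0, 0xd7c96534210ba8), (0, 0xd9bac876210543), (2, 0xcdba9876210453),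
    (0, 0xd9bac867210543), (2, 0xcdba9867210453), (0, 0xd9b87a6c435210), (2, 0xbd43a59c102786),
    (0, 0xdcba9876201543), (2, 0xcd7698ba201453), (2, 0xbd43a59c201786), (2, 0xbd43a5c9102786),
    (2, 0xbdc9a534210786), (0, 0xdcba9876210543), (2, 0xbd43a5c9210786), (2, 0xcd7698ba210453),
    (2, 0xbd43a59c210786)]⟩,
   ⟨[0x012, 0x345, 0x678, 0x8ab], 0xba4d369c728105, 14, [(1, 0xdcba9867102543),
    (1, 0xd9bac876543210), (1, 0xcdba9876543210), (1, 0xcd7698ba534210), (1, 0xd9bac867201543),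
    (1, 0xdcba9867201543), (1, 0xd9bac867102543), (0, 0xdcba9876210543), (1, 0xd9bac876102543),
    (1, 0xdcba9876102543), (1, 0xdcba9876543210), (0, 0xdcba9876354210), (0, 0xcdba9876354210),
    (0, 0x9dbac876354210), (0, 0xcdba9876453210), (1, 0xd976c8ba543210), (1, 0xcd7698ba543210),
    (1, 0xcd7698ab534210), (1, 0xcd7698ab543210), (0, 0xdcba9876543210), (1, 0xd9bac876201543),
    (1, 0xdcba9876201543), (1, 0xd9bac876210543), (1, 0xdcba9876210543), (1, 0xd9bac867210543),
    (1, 0xdcba9867210543), (1, 0xcdba9867102543), (1, 0xcdba9876102543), (0, 0x9dbac876210543),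
    (0, 0xcdba9876210543), (1, 0xcdba9876201543), (1, 0xcdba9867201543), (0, 0xdcba9876120543),
    (0, 0xcdba9876120543), (0, 0x9dbac876120543), (1, 0xd9bac867534210), (1, 0xdcba9867534210),
    (1, 0xcdba9867534210), (1, 0xd9bac876534210), (1, 0xdcba9876534210), (1, 0xcdba9876534210),
    (0, 0x9dbac876453210), (0, 0xdcba9876453210), (1, 0xd9bac867543210), (1, 0xdcba9867543210),
    (1, 0xcdba9867543210)]⟩,
   ⟨[0x012, 0x345, 0x678, 0x059], 0xcb43da29107568, 14, [(0, 0xdca9b210876543),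
    (2, 0xc9dab210435876), (2, 0xc9dab345210876), (2, 0xd9cba435210876), (0, 0xdca9b786543210),
    (0, 0xcbd9a210876543), (0, 0xdca9b120876543), (0, 0xcbd9a120876543), (2, 0xc9dab120435876),
    (2, 0xc9dab435210876), (0, 0xcbd9a453876210), (0, 0xdca9b453876210), (0, 0xcbd9a354876210),
    (0, 0xdca9b354876210), (2, 0xc9dba435210876), (2, 0xd9bac435210876), (2, 0xc9dba345210876),
    (2, 0xd9bac345210876), (0, 0xdc71b543982a60), (0, 0xdc81b543972a60), (0, 0xdc82b543971a60),
    (0, 0xdc72b543981a60), (0, 0xdc61b543982a70), (0, 0xdc81b543962a70), (0, 0xdc82b543961a70),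
    (0, 0xdc62b543981a70), (0, 0xdc61b543972a80), (0, 0xdc71b543962a80), (0, 0xdc72b543961a80),
    (0, 0xdc62b543971a80), (0, 0xcbd9a786543210), (0, 0xcbd9a687543210), (0, 0xdca9b687543210),
    (0, 0xcb908543d72a61), (0, 0xcb908543a72d61), (0, 0xcb908543d62a71), (0, 0xcb908543a62d71),
    (0, 0xcbd18543972a60), (0, 0xcbd28543971a60), (0, 0xcba18543972d60), (0, 0xcba28543971d60),
    (0, 0xcbd18543962a70), (0, 0xcbd28543961a70), (0, 0xcba18543962d70), (0, 0xcba28543961d70),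
    (0, 0xcbda9021876543), (0, 0xcbda9543876210), (0, 0xcb924786d51a30), (0, 0xcb914786d52a30),
    (0, 0xcb924786a51d30), (0, 0xcb914786a52d30), (0, 0xcbd24786a31950), (0, 0xcba24786d31950),
    (0, 0xcba14786d32950), (0, 0xcbd14786a32950), (0, 0xcba04786d52931), (0, 0xcba04786932d51),
    (0, 0xcbd04786a52931), (0, 0xcbd04786932a51), (0, 0xcbd25786941a30), (2, 0xc2a3b059867d41),
    (2, 0xc1a3b059867d42), (0, 0xcbd15786942a30), (0, 0xcba25786941d30), (2, 0xc2d3b059867a41),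
    (2, 0xc1d3b059867a42), (0, 0xcba15786942d30), (0, 0xcbd25786931a40), (2, 0xc2a4b059867d31),
    (2, 0xc1a4b059867d32), (0, 0xcbd15786932a40), (0, 0xcba25786931d40), (2, 0xc2d4b059867a31),
    (2, 0xc1d4b059867a32), (0, 0xcba15786932d40), (2, 0xca31b950867d42), (2, 0xca42b950867d31),
    (2, 0xca41b950867d32), (2, 0xca32b950867d41), (2, 0xcd31b950867a42), (2, 0xcd42b950867a31),
    (2, 0xcd41b950867a32), (2, 0xcd32b950867a41), (2, 0xc9dba210435876), (0, 0xdcb9a210876543),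
    (0, 0xdcb9a120876543), (2, 0xc9dba120435876), (2, 0xd9bac210435876), (2, 0xd9bac120435876),
    (0, 0xdcba9021876543), (0, 0xcadb9021876543), (2, 0xb9dca210435876), (2, 0xd9cab210435876),
    (2, 0xd9cab120435876), (2, 0xb9dca120435876)]⟩,
   ⟨[0x012, 0x345, 0x678], 0x759618203d4cab, 0, [(1, 0xdbca9453876210), (1, 0xbadc9453876210),
    (0, 0xcba9d876354210), (0, 0xdcba9543687201), (0, 0xdcba9210687435), (0, 0xdcba9210786435),
    (1, 0xdbca9354876210), (1, 0xcbda9354876210), (1, 0xdacb9354876210), (1, 0xbadc9354876210),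
    (0, 0xdba9c876354210), (0, 0xdba9c876453210), (0, 0xcba9d876453210), (0, 0xcba9d876453102),
    (0, 0xcba9d876354102), (0, 0xcba9d210876543), (0, 0xdcba9543876102), (0, 0xdcba9543687102),
    (0, 0xdcba9543876201), (0, 0xdcba9876543201), (1, 0xdbca9210876543), (1, 0xcbda9210876543),
    (1, 0xdacb9210876543), (1, 0xbadc9210876543), (0, 0xdcb9a876354210), (0, 0xdca9b876354210),
    (0, 0xdcb9a876453210), (0, 0xdca9b876453210), (0, 0xdcb9a543876210), (0, 0xdca9b543876210),
    (0, 0xdba9c543876210), (0, 0xcba9d543876210), (1, 0xdcba9021876543), (1, 0xdbca9021876543),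
    (1, 0xcbda9021876543), (1, 0xdacb9021876543), (1, 0xcadb9021876543), (1, 0xbadc9021876543),
    (0, 0xdba9c210876543), (1, 0xcbda9120876543), (1, 0xbadc9120876543), (0, 0xdba9c210687543),
    (0, 0xcba9d210687543), (0, 0xdba9c876453201), (0, 0xcba9d876453201), (0, 0xcba9d543876201),
    (0, 0xcba9d543687201), (0, 0xdba9c876354201), (0, 0xcba9d876354201), (0, 0xcba9d543687210),
    (0, 0xdcba9210687543), (0, 0xdcba9210876543), (1, 0xcbd9a210876543), (0, 0xdcba9876453201),
    (1, 0xcbd9a120876543), (0, 0xdcba9876354210), (0, 0xdcba9876354201), (0, 0xdcba9876453210),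
    (1, 0xcbd9a021876543), (0, 0xdcba9876543210), (0, 0xdcba9543687210), (0, 0xdcba9543876210),
    (0, 0xdcba9543786102), (0, 0xdcba9543786201), (0, 0xdcba9543786210)]⟩]

theorem certifies_3_14 : certifies 14 3 true [] certificate_3_14 = true := by
  decide +kernel

end SequenceCertificate

/-! ### Reduction to finitely many certificates -/

theorem theorem4 {V : Type*} [Fintype V] [DecidableEq V] (T : PartialSteinerTripleSystem V)
    (hT : T.AtMostDisjointBlocks 3) : T.Sequenceable := by
  have hex : ∃ K ≤ 3, T.AtMostDisjointBlocks K ∧ ∃ S, T.IsDisjointBlocks S ∧ S.card = K := by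
    classical
    have h : ∃ K, T.AtMostDisjointBlocks K := ⟨3, hT⟩
    -- The least valid bound is attained: the bound one below it fails, and the family witnessing
    -- this has exactly that many blocks.
    refine ⟨Nat.find h, Nat.find_min' h hT, Nat.find_spec h, ?_⟩
    rcases Nat.eq_zero_or_pos (Nat.find h) with h0 | h0
    · exact ⟨∅, ⟨by simp, by simp⟩, by simp [h0]⟩
    · have hnot := Nat.find_min h (Nat.sub_lt h0 one_pos)
      simp only [PartialSteinerTripleSystem.AtMostDisjointBlocks, not_forall, not_le] at hnot
      obtain ⟨S, hS, hlt⟩ := hnot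
      have := Nat.find_spec h S hS
      exact ⟨S, hS, by omega⟩
  obtain ⟨K, hK3, hK, S, hS, hSK⟩ := hex
  have hcard : 3 * K ≤ Fintype.card V := by
    rw [← hSK, ← SequenceCertificate.card_of_isDisjointBlocks hS]
    exact Finset.card_le_univ _
  open SequenceCertificate in
  have exact_size : ∀ {n : ℕ} {ss : List Step}, K ≠ 0 → Fintype.card V = n →
      certifies n K false [] ss = true → T.Sequenceable := fun hK0 hn h =>
    sequenceable_of_certifies hK3 hK hS hSK hK0 hn.ge (fun _ => hn.symm) h
  open SequenceCertificate in
  have large : ∀ {n : ℕ} {ss : List Step}, K ≠ 0 → n ≤ Fintype.card V →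
      certifies n K true [] ss = true → T.Sequenceable := fun hK0 hn h =>
    sequenceable_of_certifies hK3 hK hS hSK hK0 hn (by simp) h
  open SequenceCertificate in
  -- The `K` disjoint blocks already occupy 3K points, so the sizes start there.
  interval_cases K
  · exact sequenceable_of_atMost_zero hK
  · obtain hn | hn | hn | hn : Fintype.card V = 3 ∨ Fintype.card V = 4 ∨ Fintype.card V = 5 ∨
        6 ≤ Fintype.card V := by omega
    · exact exact_size one_ne_zero hn certifies_1_3
    · exact exact_size one_ne_zero hn certifies_1_4
    · exact exact_size one_ne_zero hn certifies_1_5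
    · exact large one_ne_zero hn certifies_1_6
  · obtain hn | hn | hn | hn : Fintype.card V = 6 ∨ Fintype.card V = 7 ∨ Fintype.card V = 8 ∨
        9 ≤ Fintype.card V := by omega
    · exact exact_size two_ne_zero hn certifies_2_6
    · exact exact_size two_ne_zero hn certifies_2_7
    · exact exact_size two_ne_zero hn certifies_2_8
    · exact large two_ne_zero hn certifies_2_9
  · obtain hn | hn | hn | hn | hn | hn : Fintype.card V = 9 ∨ Fintype.card V = 10 ∨
        Fintype.card V = 11 ∨ Fintype.card V = 12 ∨ Fintype.card V = 13 ∨
        14 ≤ Fintype.card V := by omega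
    · exact exact_size three_ne_zero hn certifies_3_9
    · exact exact_size three_ne_zero hn certifies_3_10
    · exact exact_size three_ne_zero hn certifies_3_11
    · exact exact_size three_ne_zero hn certifies_3_12
    · exact exact_size three_ne_zero hn certifies_3_13
    · exact large three_ne_zero hn certifies_3_14
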